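/- Theorem 3.1. Let $\mathfrak h$ be a separable complex Hilbert space with inner product $\langle\cdot,\cdot\rangle$ (antilinear in the first variable), and let $\mathcal B=\mathcal B(\mathfrak h)$ be the algebra of bounded operators on it. Consider the formal generator $$\mathcal L(x)[u,v]=\phi(x)[u,v]-\langle Gu,xv\rangle-\langle u,xGv\rangle,\qquad u,v\in\operatorname{dom}G,\ x\in\mathcal B,$$ and write $q[u]=q[u,u]$ for a sesquilinear form $q$. Assume: (i) $-G$ is the generator of a $C_0$-semigroup of contractions $(W_t)_{t\ge0}$ on $\mathfrak h$; (ii) $\phi$ is a linear map from $\mathcal B$ to the sesquilinear forms on $\operatorname{dom}G$ that is completely positive, i.e. $\sum_{i,j}\phi(x_i^*x_j)[u_i,u_j]\ge0$ for all finite families $(x_i)$ in $\mathcal B$ and $(u_i)$ in $\operatorname{dom}G$, and normal, i.e. $\phi(\sup_\alpha x_\alpha)[u]=\sup_\alpha\phi(x_\alpha)[u]$ for every $u\in\operatorname{dom}G$ and every increasing net $(x_\alpha)$ of positive elements of $\mathcal B$ with an upper bound; (iii) $\mathcal L(I)[u]\le0$ for all $u\in\operatorname{dom}G$, equivalently $\phi(I)[u]\le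 2\operatorname{Re}\langle Gu,u\rangle$. For $x\in\mathcal B$, $t\ge0$, $\lambda>0$, define operators in $\mathcal B$ through their sesquilinear forms (with $u,v\in\operatorname{dom}G$) as follows. Put $P^{(1)}_t(x)=W_t^*xW_t$ and, for $n\ge2$, $$P^{(n)}_t(x)[u,v]=\langle u,W_t^*xW_tv\rangle+\int_0^t\phi\big(P^{(n-1)}_\tau(x)\big)[W_{t-\tau}u,W_{t-\tau}v]\,d\tau .$$ The minimal quantum dynamical semigroup $(P^{\min}_t)_{t\ge0}$ is given by $P^{\min}_t(x)=\sup_nP^{(n)}_t(x)$ for $x\ge0$, and in general by the limit of $P^{(n)}_t(x)$ in the weak operator topology. It is called conservative if $P^{\min}_t(I)=I$ for all $t\ge0$. Put $$Q_\lambda(x)[u,v]=\int_0^\infty e^{-\lambda t}\phi(x)[W_tu,W_tv]\,dt,\qquad \ell_\lambda(I)[u,v]=\int_0^\infty e^{-\lambda t}\Big(-\int_0^t\mathcal L(I)[W_{t-\tau}u,W_{t-\tau}v]\,d\tau\Big)dt,$$ and, for all $u,v\in\mathfrak h$, $$R^{\min}_\lambda(x)[u,v]=\int_0^\infty e^{-\lambda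 t}\langle u,P^{\min}_t(x)v\rangle\,dt.$$ Then all these objects are well defined: $\operatorname{dom}G$ is dense, the integrals converge absolutely, the forms are those of bounded operators, $(P^{(n)}_t(x))_n$ converges in the weak operator topology for every $x\in\mathcal B$, and for $x\ge0$ it is increasing with supremum equal to that limit. Moreover, for every $\lambda>0$, the sequence $Q^n_\lambda(I)$ converges strongly as $n\to\infty$, and the following are equivalent: (a) $(P^{\min}_t)_{t\ge0}$ is non-conservative; (b) $\ell_\lambda(I)\ne0$ or $\lim_nQ^n_\lambda(I)\ne0$; (c) $R^{\min}_\lambda(I)<\frac1\lambda I$, where $A<B$ means that $B-A$ is positive semidefinite and nonzero. -/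

import Mathlib

open Filter Topology MeasureTheory Set
open scoped NNReal ComplexOrder InnerProductSpace

noncomputable section

/-- A strongly continuous (`C₀`) one-parameter semigroup of contractions on `H`. -/
structure ContractionSemigroup (H : Type*) [NormedAddCommGroup H] [InnerProductSpace ℂ H] where
  /-- The operators `W_t`, `t ≥ 0`. -/
  op : ℝ≥0 → H →L[ℂ] H
  op_zero : op 0 = 1
  op_add : ∀ s t, op (s + t) = op s * op t
  norm_op_le : ∀ t, ‖op t‖ ≤ 1
  continuous_op : ∀ u : H, Continuous fun t => op t u

/-- `A` is the infinitesimal generator of `W`: its graph consists of all pairs `(u, v)` such that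
`t⁻¹ (W_t u - u) → v` as `t → 0+`. -/
def ContractionSemigroup.HasGenerator {H : Type*} [NormedAddCommGroup H] [InnerProductSpace ℂ H]
    (W : ContractionSemigroup H) (A : H →ₗ.[ℂ] H) : Prop :=
  ∀ u v : H, (u, v) ∈ A.graph ↔
    Tendsto (fun t : ℝ≥0 => ((t : ℝ) : ℂ)⁻¹ • (W.op t u - u)) (𝓝[>] 0) (𝓝 v)

/-- The domain of the generator is invariant under the semigroup. -/
theorem ContractionSemigroup.op_mem_domain {H : Type*} [NormedAddCommGroup H]
    [InnerProductSpace ℂ H] {W : ContractionSemigroup H} {A : H →ₗ.[ℂ] H}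
    (hA : W.HasGenerator A) (s : ℝ≥0) {u : H} (hu : u ∈ A.domain) : W.op s u ∈ A.domain := by
  have h1 := (hA u (A ⟨u, hu⟩)).1 (A.mem_graph ⟨u, hu⟩)
  have h2 := ((W.op s).continuous.tendsto _).comp h1
  have h3 : (W.op s u, W.op s (A ⟨u, hu⟩)) ∈ A.graph := by
    refine (hA _ _).2 (h2.congr fun t => ?_)
    have h4 : W.op s (W.op t u) = W.op t (W.op s u) := by
      change (W.op s * W.op t) u = (W.op t * W.op s) u
      rw [← W.op_add, ← W.op_add, add_comm]
    simp [h4]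
  exact A.mem_domain_of_mem_graph h3

/-- The sesquilinear form `𝓛(x)[u, v] = φ(x)[u, v] - ⟪G u, x v⟫ - ⟪u, x (G v)⟫` on `dom G`. -/
def generatorForm {H : Type*} [NormedAddCommGroup H] [InnerProductSpace ℂ H]
    (G : H →ₗ.[ℂ] H)
    (phi : (H →L[ℂ] H) →ₗ[ℂ] (G.domain →ₗ⋆[ℂ] G.domain →ₗ[ℂ] ℂ))
    (x : H →L[ℂ] H) (u v : G.domain) : ℂ :=
  phi x u v - ⟪G u, x v⟫_ℂ - ⟪(u : H), x (G v)⟫_ℂ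

/-- A formal generator `𝓛(x) = φ(x) - G* x - x G`: `-G` generates a contraction `C₀`-semigroup
`W`, `φ` is a linear, completely positive and normal map from the bounded operators to the
sesquilinear forms on `dom G`, and `𝓛(I) ≤ 0` as a quadratic form on `dom G`. -/
structure FormalGenerator (H : Type*) [NormedAddCommGroup H] [InnerProductSpace ℂ H]
    [CompleteSpace H] where
  G : H →ₗ.[ℂ] H
  W : ContractionSemigroup H
  hasGenerator : W.HasGenerator (-G)
  phi : (H →L[ℂ] H) →ₗ[ℂ] (G.domain →ₗ⋆[ℂ] G.domain →ₗ[ℂ] ℂ)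
  completelyPositive : ∀ (n : ℕ) (u : Fin n → G.domain) (x : Fin n → (H →L[ℂ] H)),
    0 ≤ ∑ i, ∑ j, phi (star (x i) * x j) (u i) (u j)
  /-- Normality: `φ(·)[u]` respects suprema of upward directed bounded families of positive
  operators (for the usual order of operators). -/
  normal : ∀ (u : G.domain) (S : Set (H →L[ℂ] H)) (s : H →L[ℂ] H), S.Nonempty →
    DirectedOn (· ≤ ·) S → (∀ x ∈ S, 0 ≤ x) → IsLUB S s →
    IsLUB ((fun x => (phi x u u).re) '' S) (phi s u u).re
  generatorForm_one_nonpos : ∀ u : G.domain, generatorForm G phi 1 u u ≤ 0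

/-- The bounded operator `A` represents the form `q` on `D`: `⟪u, A v⟫ = q u v` for `u, v ∈ D`. -/
def Represents {H : Type*} [NormedAddCommGroup H] [InnerProductSpace ℂ H] {D : Submodule ℂ H}
    (q : D → D → ℂ) (A : H →L[ℂ] H) : Prop :=
  ∀ u v : D, ⟪(u : H), A v⟫_ℂ = q u v

open Classical in
/-- The bounded operator representing the form `q` on `D` (unique if `D` is dense); by convention
`0` if there is none. -/
def operatorOf {H : Type*} [NormedAddCommGroup H] [InnerProductSpace ℂ H] {D : Submodule ℂ H}
    (q : D → D → ℂ) : H →L[ℂ] H :=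
  if h : ∃ A, Represents q A then h.choose else 0

namespace FormalGenerator

variable {H : Type*} [NormedAddCommGroup H] [InnerProductSpace ℂ H] [CompleteSpace H]
  (L : FormalGenerator H)

/-- `W_s u`, as an element of `dom G`, for a real time `s ≥ 0` (`s` is replaced by `0` when it is
negative; only nonnegative times occur below). -/
def orbit (s : ℝ) (u : L.G.domain) : L.G.domain :=
  ⟨L.W.op s.toNNReal u, ContractionSemigroup.op_mem_domain L.hasGenerator _ u.2⟩

/-- The form `⟪u, W_t* x W_t v⟫ + ∫₀ᵗ φ(p τ)[W_{t-τ} u, W_{t-τ} v] dτ`. -/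
def iterateForm (p : ℝ≥0 → H →L[ℂ] H) (t : ℝ≥0) (x : H →L[ℂ] H) (u v : L.G.domain) : ℂ :=
  ⟪L.W.op t u, x (L.W.op t v)⟫_ℂ +
    ∫ τ in (0 : ℝ)..t, L.phi (p τ.toNNReal) (L.orbit (t - τ) u) (L.orbit (t - τ) v)

/-- The iterates approximating the minimal semigroup, counted from `0`:
`P⁽⁰⁾_t(x) = W_t* x W_t`, and `P⁽ⁿ⁺¹⁾_t(x)` is the operator of the form
`⟪u, W_t* x W_t v⟫ + ∫₀ᵗ φ(P⁽ⁿ⁾_τ(x))[W_{t-τ} u, W_{t-τ} v] dτ` on `dom G`. -/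
def iterate : ℕ → ℝ≥0 → (H →L[ℂ] H) → (H →L[ℂ] H)
  | 0 => fun t x => star (L.W.op t) * x * L.W.op t
  | n + 1 => fun t x => operatorOf (L.iterateForm (fun τ => iterate n τ x) t x)

open Classical in
/-- The minimal quantum dynamical semigroup: `P_t(x)` is the limit of the iterates `P⁽ⁿ⁾_t(x)` in
the weak operator topology. For `x ≥ 0` this is their supremum, and it is linear in `x`. -/
def minSemigroup (t : ℝ≥0) (x : H →L[ℂ] H) : H →L[ℂ] H :=
  if h : ∃ A : H →L[ℂ] H, ∀ u v : H,
      Tendsto (fun n => ⟪u, L.iterate n t x v⟫_ℂ) atTop (𝓝 ⟪u, A v⟫_ℂ)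
  then h.choose else 0

/-- The minimal quantum dynamical semigroup is conservative: `P_t(I) = I` for all `t ≥ 0`. -/
def IsConservative : Prop := ∀ t : ℝ≥0, L.minSemigroup t 1 = 1

/-- `R_r(x)[u, v] = ∫₀^∞ e^{-rt} ⟪u, P_t(x) v⟫ dt`, a form on all of `H`. -/
def resolventForm (r : ℝ) (x : H →L[ℂ] H) (u v : (⊤ : Submodule ℂ H)) : ℂ :=
  ∫ t in Ioi (0 : ℝ), (Real.exp (-r * t) : ℂ) * ⟪(u : H), L.minSemigroup t.toNNReal x v⟫_ℂ

/-- The resolvent `R_r` of the minimal semigroup. -/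
def resolvent (r : ℝ) (x : H →L[ℂ] H) : H →L[ℂ] H := operatorOf (L.resolventForm r x)

/-- `Q_r(x)[u, v] = ∫₀^∞ e^{-rt} φ(x)[W_t u, W_t v] dt`, a form on `dom G`. -/
def QForm (r : ℝ) (x : H →L[ℂ] H) (u v : L.G.domain) : ℂ :=
  ∫ t in Ioi (0 : ℝ), (Real.exp (-r * t) : ℂ) * L.phi x (L.orbit t u) (L.orbit t v)

/-- The bounded operator `Q_r(x)`. -/
def Q (r : ℝ) (x : H →L[ℂ] H) : H →L[ℂ] H := operatorOf (L.QForm r x)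

/-- `-∫₀ᵗ 𝓛(I)[W_{t-τ} u, W_{t-τ} v] dτ`. -/
def defect (t : ℝ) (u v : L.G.domain) : ℂ :=
  -∫ τ in (0 : ℝ)..t, generatorForm L.G L.phi 1 (L.orbit (t - τ) u) (L.orbit (t - τ) v)

/-- `ℓ_r(I)[u, v] = ∫₀^∞ e^{-rt} (-∫₀ᵗ 𝓛(I)[W_{t-τ} u, W_{t-τ} v] dτ) dt`, a form on `dom G`. -/
def ellForm (r : ℝ) (u v : L.G.domain) : ℂ :=
  ∫ t in Ioi (0 : ℝ), (Real.exp (-r * t) : ℂ) * L.defect t u v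

/-- The bounded operator `ℓ_r(I)`. -/
def ell (r : ℝ) : H →L[ℂ] H := operatorOf (L.ellForm r)

/-- All objects above are well defined: the integrals in their definitions converge absolutely, the
forms are those of bounded operators, and the iterates converge, increasingly for `x ≥ 0`. -/
structure WellDefined : Prop where
  dense_domain : Dense (L.G.domain : Set H)
  iterate_integrable : ∀ (n : ℕ) (t : ℝ≥0) (x : H →L[ℂ] H) (u v : L.G.domain),
    IntervalIntegrable (fun τ : ℝ =>
      L.phi (L.iterate n τ.toNNReal x) (L.orbit (t - τ) u) (L.orbit (t - τ) v)) volume 0 t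
  iterate_represents : ∀ (n : ℕ) (t : ℝ≥0) (x : H →L[ℂ] H),
    Represents (L.iterateForm (fun τ => L.iterate n τ x) t x) (L.iterate (n + 1) t x)
  iterate_monotone : ∀ (t : ℝ≥0) (x : H →L[ℂ] H), 0 ≤ x → Monotone fun n => L.iterate n t x
  minSemigroup_isLUB : ∀ (t : ℝ≥0) (x : H →L[ℂ] H), 0 ≤ x →
    IsLUB (range fun n => L.iterate n t x) (L.minSemigroup t x)
  minSemigroup_tendsto : ∀ (t : ℝ≥0) (x : H →L[ℂ] H) (u v : H),
    Tendsto (fun n => ⟪u, L.iterate n t x v⟫_ℂ) atTop (𝓝 ⟪u, L.minSemigroup t x v⟫_ℂ)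
  resolvent_integrable : ∀ (r : ℝ), 0 < r → ∀ (x : H →L[ℂ] H) (u v : H),
    IntegrableOn (fun t : ℝ => (Real.exp (-r * t) : ℂ) * ⟪u, L.minSemigroup t.toNNReal x v⟫_ℂ)
      (Ioi 0)
  resolvent_represents : ∀ (r : ℝ), 0 < r → ∀ x : H →L[ℂ] H,
    Represents (L.resolventForm r x) (L.resolvent r x)
  Q_integrable : ∀ (r : ℝ), 0 < r → ∀ (x : H →L[ℂ] H) (u v : L.G.domain),
    IntegrableOn (fun t : ℝ => (Real.exp (-r * t) : ℂ) * L.phi x (L.orbit t u) (L.orbit t v))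
      (Ioi 0)
  Q_represents : ∀ (r : ℝ), 0 < r → ∀ x : H →L[ℂ] H, Represents (L.QForm r x) (L.Q r x)
  defect_integrable : ∀ (t : ℝ), 0 ≤ t → ∀ u v : L.G.domain,
    IntervalIntegrable (fun τ : ℝ =>
      generatorForm L.G L.phi 1 (L.orbit (t - τ) u) (L.orbit (t - τ) v)) volume 0 t
  ell_integrable : ∀ (r : ℝ), 0 < r → ∀ u v : L.G.domain,
    IntegrableOn (fun t : ℝ => (Real.exp (-r * t) : ℂ) * L.defect t u v) (Ioi 0)
  ell_represents : ∀ (r : ℝ), 0 < r → Represents (L.ellForm r) (L.ell r)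

end FormalGenerator

end

/-! Two facts drive the argument. The first is the energy balance: along an orbit, the derivative of
`⟪W_s u, W_s v⟫` is `-⟪G W_s u, W_s v⟫ - ⟪W_s u, G W_s v⟫`. With `φ(I)[u] ≤ 2 Re ⟪G u, u⟫` it gives
`∫₀ᵗ φ(I)[W_s u] ds ≤ ‖u‖² - ‖W_t u‖²` (`integral_phiOne_orbit_le`). Complete positivity yields a
Cauchy-Schwarz inequality and hence `|φ(x)[u, v]| ≤ ‖x‖/2 (φ(I)[u] + φ(I)[v])` (`norm_phi_le`).
Together they bound every form by `‖x‖`, so the iterates and `Q_λ` are contractive; positivity makes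
the iterates increase for `x ≥ 0`, and weak limits exist.

The second is that the Laplace transform turns the convolution in the recursion into a composition.
Write `R⁽ⁿ⁾` for the transform of `P⁽ⁿ⁾(I)`. Then `R⁽ⁿ⁺¹⁾ = R⁽⁰⁾ + Q(R⁽ⁿ⁾)`
(`laplace_iterate_succ`), while the energy balance gives `ℓ = λ⁻¹ I - R⁽⁰⁾ - Q(λ⁻¹ I)` (`ell_eq`).
Pulling `φ` out of the weak integral needs normality: compression by finite-rank projections makes
`φ(·)[u, v]` a uniform limit, on bounded sets, of combinations of matrix coefficients.

For `Dₙ = λ⁻¹ I - R⁽ⁿ⁾` these identities read `D₀ = ℓ + λ⁻¹ Q(I)` and `Dₙ₊₁ = ℓ + Q(Dₙ)`, so `Dₙ =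
∑_{k ≤ n} Q^k(ℓ) + λ⁻¹ Q^{n+1}(I)` with all terms positive. In the limit, `λ⁻¹ I - R^min(I)`
vanishes exactly when `ℓ = 0` and `lim Qⁿ(I) = 0` (`resolvent_one_eq_iff`). It is also the Laplace
transform of the positive, weakly continuous family `I - P^min_t(I)`, so it vanishes exactly in the
conservative case (`isConservative_iff_resolvent_one_eq`). -/

section Forms

/-! ### Bounded sesquilinear forms, the operator order and weak convergence. -/

variable {H : Type*} [NormedAddCommGroup H] [InnerProductSpace ℂ H] {D : Submodule ℂ H}

/-- The function `q` on `D × D` is sesquilinear, antilinear in its first argument. -/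
structure IsSesquilinear (q : D → D → ℂ) : Prop where
  add_left : ∀ u u' v, q (u + u') v = q u v + q u' v
  smul_left : ∀ (c : ℂ) u v, q (c • u) v = starRingEnd ℂ c * q u v
  add_right : ∀ u v v', q u (v + v') = q u v + q u v'
  smul_right : ∀ (c : ℂ) u v, q u (c • v) = c * q u v

namespace IsSesquilinear

variable {q q' : D → D → ℂ}

theorem of_linearMap (f : D →ₗ⋆[ℂ] D →ₗ[ℂ] ℂ) : IsSesquilinear fun u v => f u v where
  add_left u u' v := by simp
  smul_left c u v := by simp
  add_right u v v' := by simp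
  smul_right c u v := by simp

theorem inner_apply (S T A : H →L[ℂ] H) :
    IsSesquilinear fun u v : D => ⟪S u, A (T v)⟫_ℂ where
  add_left u u' v := by simp
  smul_left c u v := by simp [mul_comm]
  add_right u v v' := by simp
  smul_right c u v := by simp

theorem add (hq : IsSesquilinear q) (hq' : IsSesquilinear q') :
    IsSesquilinear fun u v => q u v + q' u v where
  add_left u u' v := by rw [hq.add_left, hq'.add_left]; ring
  smul_left c u v := by rw [hq.smul_left, hq'.smul_left]; ring
  add_right u v v' := by rw [hq.add_right, hq'.add_right]; ring
  smul_right c u v := by rw [hq.smul_right, hq'.smul_right]; ring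

theorem const_mul (hq : IsSesquilinear q) (a : ℂ) : IsSesquilinear fun u v => a * q u v where
  add_left u u' v := by rw [hq.add_left]; ring
  smul_left c u v := by rw [hq.smul_left]; ring
  add_right u v v' := by rw [hq.add_right]; ring
  smul_right c u v := by rw [hq.smul_right]; ring

theorem comp (hq : IsSesquilinear q) (f : D →ₗ[ℂ] D) :
    IsSesquilinear fun u v => q (f u) (f v) where
  add_left u u' v := by simp [hq.add_left]
  smul_left c u v := by simp [hq.smul_left]
  add_right u v v' := by simp [hq.add_right]
  smul_right c u v := by simp [hq.smul_right]

theorem integral {α : Type*} [MeasurableSpace α] {μ : Measure α} {F : α → D → D → ℂ}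
    (hF : ∀ a, IsSesquilinear (F a)) (hi : ∀ u v, Integrable (fun a => F a u v) μ) :
    IsSesquilinear fun u v => ∫ a, F a u v ∂μ where
  add_left u u' v := by simp_rw [(hF _).add_left]; exact integral_add (hi _ _) (hi _ _)
  smul_left c u v := by simp_rw [(hF _).smul_left]; exact integral_const_mul _ _
  add_right u v v' := by simp_rw [(hF _).add_right]; exact integral_add (hi _ _) (hi _ _)
  smul_right c u v := by simp_rw [(hF _).smul_right]; exact integral_const_mul _ _

theorem intervalIntegral {a b : ℝ} {F : ℝ → D → D → ℂ}
    (hF : ∀ a, IsSesquilinear (F a)) (hi : ∀ u v, IntervalIntegrable (fun t => F t u v) volume a b) :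
    IsSesquilinear fun u v => ∫ t in a..b, F t u v where
  add_left u u' v := by
    simp_rw [(hF _).add_left]; exact intervalIntegral.integral_add (hi _ _) (hi _ _)
  smul_left c u v := by
    simp_rw [(hF _).smul_left]; exact intervalIntegral.integral_const_mul _ _
  add_right u v v' := by
    simp_rw [(hF _).add_right]; exact intervalIntegral.integral_add (hi _ _) (hi _ _)
  smul_right c u v := by
    simp_rw [(hF _).smul_right]; exact intervalIntegral.integral_const_mul _ _

/-- Normalizing both vectors turns the additive bound into a multiplicative one. The additive shape
is the one that integrating `φ(I)[u] + φ(I)[v]` produces. -/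
theorem norm_le_mul (hq : IsSesquilinear q) {C : ℝ}
    (hb : ∀ u v, ‖q u v‖ ≤ C / 2 * (‖u‖ ^ 2 + ‖v‖ ^ 2)) (u v : D) : ‖q u v‖ ≤ C * ‖u‖ * ‖v‖ := by
  have h0u : ∀ w, q 0 w = 0 := fun w => by simpa using hq.smul_left 0 0 w
  have h0v : ∀ w, q w 0 = 0 := fun w => by simpa using hq.smul_right 0 w 0
  rcases eq_or_ne u 0 with rfl | hu
  · simp [h0u]
  rcases eq_or_ne v 0 with rfl | hv
  · simp [h0v]
  have hu' : 0 < ‖u‖ := norm_pos_iff.2 hu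
  have hv' : 0 < ‖v‖ := norm_pos_iff.2 hv
  have h := hb (((‖u‖⁻¹ : ℝ) : ℂ) • u) (((‖v‖⁻¹ : ℝ) : ℂ) • v)
  rw [hq.smul_left, hq.smul_right, norm_smul, norm_smul] at h
  simp only [norm_mul, RCLike.norm_conj, Complex.norm_real, norm_inv, norm_norm,
    inv_mul_cancel₀ hu'.ne', inv_mul_cancel₀ hv'.ne'] at h
  rw [← mul_assoc, ← mul_inv, inv_mul_le_iff₀ (by positivity)] at h
  linarith

end IsSesquilinear

theorem Represents.inner_eq {q : D → D → ℂ} {A : H →L[ℂ] H} (h : Represents q A) (u v : D) :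
    ⟪(u : H), A v⟫_ℂ = q u v := h u v

theorem dense_induction₂ (hD : Dense (D : Set H)) {p : H → H → Prop}
    (hc : IsClosed {z : H × H | p z.1 z.2}) (h : ∀ u v : D, p u v) (u v : H) : p u v :=
  DenseRange.induction_on₂ (e := (Subtype.val : D → H)) hD.denseRange_val hc h u v

theorem Represents.unique (hD : Dense (D : Set H)) {q : D → D → ℂ} {A B : H →L[ℂ] H}
    (hA : Represents q A) (hB : Represents q B) : A = B := by
  ext v
  refine ext_inner_left ℂ fun u => ?_
  exact dense_induction₂ hD (p := fun u v => ⟪u, A v⟫_ℂ = ⟪u, B v⟫_ℂ)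
    (isClosed_eq (by fun_prop) (by fun_prop)) (fun u v => (hA u v).trans (hB u v).symm) u v

theorem Represents.operatorOf {q : D → D → ℂ} {A : H →L[ℂ] H} (hA : Represents q A) :
    Represents q (operatorOf q) := by
  have h : ∃ A, Represents q A := ⟨A, hA⟩
  rw [_root_.operatorOf, dif_pos h]
  exact h.choose_spec

theorem Represents.norm_le (hD : Dense (D : Set H)) {q : D → D → ℂ} {A : H →L[ℂ] H}
    (hA : Represents q A) {C : ℝ} (hC : 0 ≤ C)
    (hb : ∀ u v, ‖q u v‖ ≤ C / 2 * (‖u‖ ^ 2 + ‖v‖ ^ 2)) : ‖A‖ ≤ C := by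
  have key : ∀ u v : H, ‖⟪u, A v⟫_ℂ‖ ≤ C / 2 * (‖u‖ ^ 2 + ‖v‖ ^ 2) := by
    refine dense_induction₂ hD (isClosed_le (by fun_prop) (by fun_prop)) fun u v => ?_
    rw [hA u v]
    exact hb u v
  refine ContinuousLinearMap.opNorm_le_of_re_inner_le hC fun x y hx hy => ?_
  have h := key y x
  rw [hx, hy, ← norm_inner_symm] at h
  calc _ ≤ ‖⟪A x, y⟫_ℂ‖ := RCLike.re_le_norm _
    _ ≤ _ := h
    _ = C := by ring

/-- The form is extended by density in its first variable, flipped, and extended in the other; the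
Riesz theorem then applies on all of `H`. -/
theorem IsSesquilinear.exists_represents [CompleteSpace H] (hD : Dense (D : Set H))
    {q : D → D → ℂ} (hq : IsSesquilinear q) {C : ℝ}
    (hb : ∀ u v, ‖q u v‖ ≤ C / 2 * (‖u‖ ^ 2 + ‖v‖ ^ 2)) :
    ∃ A : H →L[ℂ] H, Represents q A := by
  let f : D →ₗ⋆[ℂ] D →ₗ[ℂ] ℂ := LinearMap.mk₂'ₛₗ (starRingEnd ℂ) (RingHom.id ℂ) q
    hq.add_left hq.smul_left hq.add_right hq.smul_right
  let B : D →L⋆[ℂ] D →L[ℂ] ℂ := f.mkContinuous₂ C (hq.norm_le_mul hb)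
  have hd : DenseRange D.subtypeL := hD.denseRange_val
  have hi : IsUniformInducing D.subtypeL := isUniformEmbedding_subtype_val.isUniformInducing
  let B1 : H →L⋆[ℂ] D →L[ℂ] ℂ := B.extend D.subtypeL
  let B2 : H →L[ℂ] H →L⋆[ℂ] ℂ := B1.flip.extend D.subtypeL
  -- Riesz puts the operator in the first slot of the inner product; the adjoint moves it to the
  -- second.
  refine ⟨ContinuousLinearMap.adjoint
    (InnerProductSpace.continuousLinearMapOfBilin B2.flip), fun u v => ?_⟩
  rw [ContinuousLinearMap.adjoint_inner_right,
    InnerProductSpace.continuousLinearMapOfBilin_apply, ContinuousLinearMap.flip_apply]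
  have h2 : B2 (v : H) = B1.flip v := B1.flip.extend_eq hd hi v
  have h1 : B1 (u : H) = B u := B.extend_eq hd hi u
  rw [h2, ContinuousLinearMap.flip_apply, h1]
  rfl

/-- In the complex order `0 ≤ z` includes `z.im = 0`, so self-adjointness comes with the condition
on the right. -/
theorem operator_nonneg_iff (A : H →L[ℂ] H) : 0 ≤ A ↔ ∀ u, 0 ≤ ⟪u, A u⟫_ℂ := by
  rw [ContinuousLinearMap.nonneg_iff_isPositive]
  refine ⟨fun h u => h.inner_nonneg_right u, fun h => ?_⟩
  rw [ContinuousLinearMap.isPositive_iff_complex]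
  intro u
  have h1 : 0 ≤ ⟪A u, u⟫_ℂ := by
    have := h u
    rw [← inner_conj_symm]
    exact star_nonneg_iff.2 this
  rw [RCLike.nonneg_iff] at h1
  refine ⟨?_, h1.1⟩
  apply RCLike.ext <;> simp [h1.2]

theorem Represents.nonneg (hD : Dense (D : Set H)) {q : D → D → ℂ} {A : H →L[ℂ] H}
    (hA : Represents q A) (hq : ∀ u, 0 ≤ q u u) : 0 ≤ A := by
  rw [operator_nonneg_iff]
  intro u
  refine hD.induction (P := fun u => 0 ≤ ⟪u, A u⟫_ℂ) (fun u hu => ?_)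
    (isClosed_le (by fun_prop) (by fun_prop)) u
  rw [hA ⟨u, hu⟩ ⟨u, hu⟩]
  exact hq _

theorem operator_le_iff (A B : H →L[ℂ] H) : A ≤ B ↔ ∀ u, ⟪u, A u⟫_ℂ ≤ ⟪u, B u⟫_ℂ := by
  rw [ContinuousLinearMap.le_def, ← ContinuousLinearMap.nonneg_iff_isPositive,
    operator_nonneg_iff]
  simp [sub_nonneg]

/-- Convergence in the weak operator topology. -/
def WeakTendsto {ι : Type*} (x : ι → H →L[ℂ] H) (l : Filter ι) (a : H →L[ℂ] H) : Prop :=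
  ∀ u v : H, Tendsto (fun i => ⟪u, x i v⟫_ℂ) l (𝓝 ⟪u, a v⟫_ℂ)

theorem norm_inner_apply_le (A : H →L[ℂ] H) (u v : H) : ‖⟪u, A v⟫_ℂ‖ ≤ ‖A‖ * ‖u‖ * ‖v‖ :=
  calc _ ≤ ‖u‖ * ‖A v‖ := norm_inner_le_norm _ _
    _ ≤ ‖u‖ * (‖A‖ * ‖v‖) := by gcongr; exact A.le_opNorm v
    _ = _ := by ring

/-- The uniform norm bound makes it possible to replace `u`, `v` by nearby vectors of `D` at a cost
uniform in the index. -/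
theorem WeakTendsto.of_dense (hD : Dense (D : Set H)) {ι : Type*} {x : ι → H →L[ℂ] H}
    {l : Filter ι} {a : H →L[ℂ] H} {C : ℝ} (hx : ∀ i, ‖x i‖ ≤ C)
    (h : ∀ u v : D, Tendsto (fun i => ⟪(u : H), x i v⟫_ℂ) l (𝓝 ⟪(u : H), a v⟫_ℂ)) :
    WeakTendsto x l a := by
  rcases l.eq_or_neBot with rfl | hl
  · exact fun u v => tendsto_bot
  obtain ⟨i0⟩ : Nonempty ι := hl.nonempty
  have hC : 0 ≤ C := (norm_nonneg _).trans (hx i0)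
  intro u v
  set K : ℝ := C + ‖a‖ + 1 with hK
  have hK0 : 0 < K := by positivity
  have hxa : ∀ i, ‖x i - a‖ ≤ K := fun i => (norm_sub_le _ _).trans (by linarith [hx i])
  rw [← tendsto_sub_nhds_zero_iff]
  rw [Metric.tendsto_nhds]
  intro ε hε
  have hδ : ∃ δ > 0, K * δ * (‖v‖ + 1) + K * (‖u‖) * δ < ε / 2 ∧ δ < 1 := by
    have : Tendsto (fun δ : ℝ => K * δ * (‖v‖ + 1) + K * ‖u‖ * δ) (𝓝[>] 0) (𝓝 0) := by
      have : Continuous (fun δ : ℝ => K * δ * (‖v‖ + 1) + K * ‖u‖ * δ) := by fun_prop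
      simpa using (this.tendsto 0).mono_left nhdsWithin_le_nhds
    have h1 := this.eventually_lt_const (half_pos hε)
    obtain ⟨δ, hδ⟩ := (h1.and ((eventually_mem_nhdsWithin).and
      (eventually_nhdsWithin_of_eventually_nhds (eventually_lt_nhds (zero_lt_one))))).exists
    exact ⟨δ, hδ.2.1, hδ.1, hδ.2.2⟩
  obtain ⟨δ, hδ0, hδε, hδ1⟩ := hδ
  obtain ⟨u', hu', huu⟩ := hD.exists_dist_lt u hδ0
  obtain ⟨v', hv', hvv⟩ := hD.exists_dist_lt v hδ0
  rw [dist_eq_norm] at huu hvv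
  have h2 := (tendsto_sub_nhds_zero_iff.2 (h ⟨u', hu'⟩ ⟨v', hv'⟩)).norm.eventually_lt_const
    (u := ε / 2) (by simpa using half_pos hε)
  filter_upwards [h2] with i hi
  have hv'n : ‖v'‖ ≤ ‖v‖ + 1 := by
    calc ‖v'‖ = ‖v - (v - v')‖ := by simp
      _ ≤ ‖v‖ + ‖v - v'‖ := norm_sub_le _ _
      _ ≤ _ := by linarith
  have e1 : ⟪u, x i v⟫_ℂ - ⟪u, a v⟫_ℂ =
      ⟪u - u', (x i - a) v'⟫_ℂ + ⟪u, (x i - a) (v - v')⟫_ℂ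
        + (⟪u', x i v'⟫_ℂ - ⟪u', a v'⟫_ℂ) := by
    simp only [sub_apply, map_sub, inner_sub_left, inner_sub_right]
    ring
  rw [dist_zero_right, e1]
  have b1 : ‖⟪u - u', (x i - a) v'⟫_ℂ‖ ≤ K * δ * (‖v‖ + 1) :=
    (norm_inner_apply_le _ _ _).trans (by gcongr; exact hxa i)
  have b2 : ‖⟪u, (x i - a) (v - v')⟫_ℂ‖ ≤ K * ‖u‖ * δ :=
    (norm_inner_apply_le _ _ _).trans (by gcongr; exact hxa i)
  calc _ ≤ _ := norm_add₃_le
    _ < ε := by linarith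

theorem WeakTendsto.unique {ι : Type*} {x : ι → H →L[ℂ] H} {l : Filter ι} [l.NeBot]
    {a b : H →L[ℂ] H} (ha : WeakTendsto x l a) (hb : WeakTendsto x l b) : a = b := by
  ext v
  exact ext_inner_left ℂ fun u => tendsto_nhds_unique (ha u v) (hb u v)

theorem WeakTendsto.norm_le {ι : Type*} {x : ι → H →L[ℂ] H} {l : Filter ι} [l.NeBot]
    {a : H →L[ℂ] H} (ha : WeakTendsto x l a) {C : ℝ} (hx : ∀ i, ‖x i‖ ≤ C) : ‖a‖ ≤ C := by
  obtain ⟨i0⟩ : Nonempty ι := NeBot.nonempty l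
  have hC : 0 ≤ C := (norm_nonneg _).trans (hx i0)
  refine ContinuousLinearMap.opNorm_le_of_re_inner_le hC fun u v hu hv => ?_
  have h1 : ‖⟪v, a u⟫_ℂ‖ ≤ C := le_of_tendsto (ha v u).norm (Eventually.of_forall fun i =>
    (norm_inner_apply_le (x i) v u).trans (by rw [hu, hv, mul_one, mul_one]; exact hx i))
  rw [← norm_inner_symm] at h1
  exact (RCLike.re_le_norm _).trans h1

theorem WeakTendsto.le {x y : ℕ → H →L[ℂ] H} {a b : H →L[ℂ] H} (ha : WeakTendsto x atTop a)
    (hb : WeakTendsto y atTop b) (h : ∀ n, x n ≤ y n) : a ≤ b :=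
  (operator_le_iff _ _).2 fun u => le_of_tendsto_of_tendsto' (ha u u) (hb u u) fun n =>
    (operator_le_iff _ _).1 (h n) u

theorem inner_apply_polarization (A : H →L[ℂ] H) (u v : H) :
    ⟪u, A v⟫_ℂ = 4⁻¹ * (⟪u + v, A (u + v)⟫_ℂ - ⟪u - v, A (u - v)⟫_ℂ
      - Complex.I * ⟪u + Complex.I • v, A (u + Complex.I • v)⟫_ℂ
      + Complex.I * ⟪u - Complex.I • v, A (u - Complex.I • v)⟫_ℂ) := by
  simp only [map_add, map_sub, map_smul, inner_add_left, inner_add_right, inner_sub_left,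
    inner_sub_right, inner_smul_left, inner_smul_right, Complex.conj_I]
  ring_nf
  simp only [Complex.I_sq]
  ring

theorem operator_ext_quadratic {A B : H →L[ℂ] H} (h : ∀ u, ⟪u, A u⟫_ℂ = ⟪u, B u⟫_ℂ) : A = B := by
  ext v
  refine ext_inner_left ℂ fun u => ?_
  rw [inner_apply_polarization A, inner_apply_polarization B]
  simp only [h]

theorem exists_weakTendsto_of_forall_tendsto [CompleteSpace H] {ι : Type*} {x : ι → H →L[ℂ] H}
    {l : Filter ι} [l.NeBot] {C : ℝ} (hx : ∀ i, ‖x i‖ ≤ C)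
    (h : ∀ u v : H, ∃ z, Tendsto (fun i => ⟪u, x i v⟫_ℂ) l (𝓝 z)) :
    ∃ a : H →L[ℂ] H, WeakTendsto x l a := by
  choose q hq using h
  have hs : IsSesquilinear (D := (⊤ : Submodule ℂ H)) fun u v => q (u : H) (v : H) :=
    { add_left := fun u u' v => by
        refine tendsto_nhds_unique (hq _ _) (((hq u v).add (hq u' v)).congr fun i => ?_)
        simp
      smul_left := fun c u v => by
        refine tendsto_nhds_unique (hq _ _)
          (((hq u v).const_mul (starRingEnd ℂ c)).congr fun i => ?_)
        simp [mul_comm]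
      add_right := fun u v v' => by
        refine tendsto_nhds_unique (hq _ _) (((hq u v).add (hq u v')).congr fun i => ?_)
        simp
      smul_right := fun c u v => by
        refine tendsto_nhds_unique (hq _ _) (((hq u v).const_mul c).congr fun i => ?_)
        simp }
  obtain ⟨i0⟩ : Nonempty ι := NeBot.nonempty l
  have hC : 0 ≤ C := (norm_nonneg _).trans (hx i0)
  obtain ⟨a, ha⟩ := hs.exists_represents (C := C) (by simp) fun u v =>
    le_of_tendsto (hq u v).norm (Eventually.of_forall fun i => by
      have h1 := norm_inner_apply_le (x i) u v
      have h2 : ‖x i‖ * ‖(u : H)‖ * ‖(v : H)‖ ≤ C * ‖(u : H)‖ * ‖(v : H)‖ := by gcongr; exact hx i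
      have h3 : 0 ≤ C / 2 * (‖(u : H)‖ - ‖(v : H)‖) ^ 2 := by positivity
      simp only [Submodule.coe_norm]
      nlinarith)
  refine ⟨a, fun u v => ?_⟩
  rw [ha ⟨u, trivial⟩ ⟨v, trivial⟩]
  exact hq u v

/-- Diagonal coefficients are real, monotone and bounded, hence convergent; polarization passes this
on to all matrix coefficients. -/
theorem exists_weakTendsto_of_monotone [CompleteSpace H] {x : ℕ → H →L[ℂ] H} (hm : Monotone x)
    (h0 : 0 ≤ x 0) {C : ℝ} (hx : ∀ i, ‖x i‖ ≤ C) : ∃ a, WeakTendsto x atTop a := by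
  have hd : ∀ u : H, ∃ z, Tendsto (fun i => ⟪u, x i u⟫_ℂ) atTop (𝓝 z) := fun u => by
    have hr : ∀ i, ((⟪u, x i u⟫_ℂ).re : ℂ) = ⟪u, x i u⟫_ℂ := fun i => by
      have := (operator_nonneg_iff _).1 (h0.trans (hm (Nat.zero_le i))) u
      exact (Complex.eq_re_of_ofReal_le (r := 0) (by simpa using this)).symm
    have h1 : Tendsto (fun i => (⟪u, x i u⟫_ℂ).re) atTop (𝓝 (⨆ i, (⟪u, x i u⟫_ℂ).re)) := by
      refine tendsto_atTop_ciSup (fun i j hij => ?_) ⟨C * ‖u‖ * ‖u‖, ?_⟩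
      · exact (Complex.le_def.1 ((operator_le_iff _ _).1 (hm hij) u)).1
      · rintro _ ⟨i, rfl⟩
        exact (Complex.re_le_norm _).trans ((norm_inner_apply_le _ _ _).trans
          (by gcongr; exact hx i))
    exact ⟨_, ((Complex.continuous_ofReal.tendsto _).comp h1).congr hr⟩
  choose z hz using hd
  refine exists_weakTendsto_of_forall_tendsto hx fun u v => ?_
  simp_rw [inner_apply_polarization (x _) u v]
  exact ⟨_, ((((hz _).sub (hz _)).sub ((hz _).const_mul _)).add ((hz _).const_mul _)).const_mul _⟩

theorem WeakTendsto.isLUB {x : ℕ → H →L[ℂ] H} (hm : Monotone x) {a : H →L[ℂ] H}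
    (ha : WeakTendsto x atTop a) : IsLUB (range x) a := by
  constructor
  · rintro _ ⟨i, rfl⟩
    refine (operator_le_iff _ _).2 fun u => ge_of_tendsto (ha u u) ?_
    filter_upwards [eventually_ge_atTop i] with j hj
    exact (operator_le_iff _ _).1 (hm hj) u
  · intro b hb
    refine (operator_le_iff _ _).2 fun u => le_of_tendsto (ha u u) (Eventually.of_forall fun i => ?_)
    exact (operator_le_iff _ _).1 (hb ⟨i, rfl⟩) u

/-- With `a = b* b` the claim is `‖b* (b u)‖² ≤ ‖b‖² ‖b u‖²`. It upgrades weak convergence of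
positive operators to strong convergence. -/
theorem norm_apply_sq_le_of_nonneg [CompleteSpace H] {a : H →L[ℂ] H} (ha : 0 ≤ a) (u : H) :
    ‖a u‖ ^ 2 ≤ ‖a‖ * (⟪u, a u⟫_ℂ).re := by
  obtain ⟨b, rfl⟩ := CStarAlgebra.nonneg_iff_eq_star_mul_self.1 ha
  have h1 : (⟪u, (star b * b) u⟫_ℂ) = ((‖b u‖ ^ 2 : ℝ) : ℂ) := by
    rw [mul_apply_eq_comp, ContinuousLinearMap.star_eq_adjoint,
      ContinuousLinearMap.adjoint_inner_right, inner_self_eq_norm_sq_to_K]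
    simp
  rw [h1, Complex.ofReal_re, CStarRing.norm_star_mul_self, mul_apply_eq_comp]
  have h2 : ‖star b (b u)‖ ≤ ‖b‖ * ‖b u‖ := by
    simpa using (star b).le_opNorm (b u)
  calc _ ≤ (‖b‖ * ‖b u‖) ^ 2 := by gcongr
    _ = _ := by ring

/-- A decreasing weakly convergent sequence of operators converges strongly. -/
theorem WeakTendsto.tendsto_apply_of_antitone [CompleteSpace H] {x : ℕ → H →L[ℂ] H}
    (hm : Antitone x) {a : H →L[ℂ] H} (ha : WeakTendsto x atTop a) (u : H) :
    Tendsto (fun n => x n u) atTop (𝓝 (a u)) := by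
  have hle : ∀ n, a ≤ x n := fun n => (operator_le_iff _ _).2 fun v => le_of_tendsto (ha v v) (by
    filter_upwards [eventually_ge_atTop n] with j hj
    exact (operator_le_iff _ _).1 (hm hj) v)
  -- The order `0 ≤ x n - a ≤ x 0 - a` bounds the operator norm uniformly in `n`, so the quadratic
  -- form controls the vector norm.
  have h1 : ∀ n, ‖x n u - a u‖ ^ 2 ≤ ‖x 0 - a‖ * (⟪u, x n u⟫_ℂ - ⟪u, a u⟫_ℂ).re := fun n => by
    have hn : 0 ≤ x n - a := sub_nonneg.2 (hle n)
    have h2 := norm_apply_sq_le_of_nonneg hn u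
    have h3 : ‖x n - a‖ ≤ ‖x 0 - a‖ :=
      CStarAlgebra.norm_le_norm_of_nonneg_of_le hn (sub_le_sub_right (hm (Nat.zero_le n)) _)
    have h4 := (Complex.le_def.1 ((operator_nonneg_iff _).1 hn u)).1
    rw [sub_apply, inner_sub_right] at h2 h4
    exact h2.trans (mul_le_mul_of_nonneg_right h3 h4)
  have h2 : Tendsto (fun n => ‖x 0 - a‖ * (⟪u, x n u⟫_ℂ - ⟪u, a u⟫_ℂ).re) atTop (𝓝 0) := by
    have := (Complex.continuous_re.tendsto _).comp (tendsto_sub_nhds_zero_iff.2 (ha u u))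
    simpa using this.const_mul ‖x 0 - a‖
  have h3 := squeeze_zero (fun n => sq_nonneg _) h1 h2
  rw [tendsto_iff_norm_sub_tendsto_zero]
  have h4 := (Real.continuous_sqrt.tendsto _).comp h3
  simpa [Function.comp_def, Real.sqrt_sq] using h4

end Forms

/-! ### The generator of a contraction semigroup. -/

namespace ContractionSemigroup

variable {H : Type*} [NormedAddCommGroup H] [InnerProductSpace ℂ H]
  (W : ContractionSemigroup H)

theorem norm_op_apply_le (t : ℝ≥0) (u : H) : ‖W.op t u‖ ≤ ‖u‖ :=
  ((W.op t).le_opNorm u).trans (by nlinarith [W.norm_op_le t, norm_nonneg u])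

theorem op_add_apply (s t : ℝ≥0) (u : H) : W.op (s + t) u = W.op s (W.op t u) := by
  rw [W.op_add]; rfl

theorem continuous_op_toNNReal (u : H) : Continuous fun t : ℝ => W.op t.toNNReal u :=
  (W.continuous_op u).comp continuous_real_toNNReal

/-- `∫₀ᵗ W_s u ds` lies in the domain of the generator, which maps it to `W_t u - u`. -/
theorem integral_op_mem_graph [CompleteSpace H] {A : H →ₗ.[ℂ] H} (hA : W.HasGenerator A) (t : ℝ≥0)
    (u : H) : (∫ s in (0 : ℝ)..t, W.op s.toNNReal u, W.op t u - u) ∈ A.graph := by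
  have hc := W.continuous_op_toNNReal u
  have hi : ∀ a b : ℝ, IntervalIntegrable (fun s : ℝ => W.op s.toNNReal u) volume a b :=
    fun a b => hc.intervalIntegrable a b
  have hshift : ∀ h : ℝ≥0, W.op h (∫ s in (0 : ℝ)..t, W.op s.toNNReal u)
      = ∫ s in (h : ℝ)..(t + h : ℝ), W.op s.toNNReal u := fun h => by
    rw [← ContinuousLinearMap.intervalIntegral_comp_comm _ (hi _ _)]
    have h1 := intervalIntegral.integral_comp_add_right (a := 0) (b := t)
      (fun s : ℝ => W.op s.toNNReal u) (h : ℝ)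
    rw [zero_add] at h1
    rw [← h1]
    refine intervalIntegral.integral_congr fun s hs => ?_
    rw [uIcc_of_le t.coe_nonneg] at hs
    rw [Real.toNNReal_add hs.1 h.coe_nonneg, Real.toNNReal_coe, add_comm s.toNNReal, W.op_add_apply]
  set F : ℝ → H := fun x => ∫ s in (0 : ℝ)..x, W.op s.toNNReal u with hF
  have hder : ∀ x : ℝ, HasDerivAt F (W.op x.toNNReal u) x := fun x =>
    intervalIntegral.integral_hasDerivAt_right (hi _ _)
      hc.stronglyMeasurable.stronglyMeasurableAtFilter hc.continuousAt
  -- Shifting the integration interval by `h` changes the integral by `∫_t^{t+h} - ∫_0^h = F (t + h)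
  -- - F h - F t`, whose derivative at `0` is the claimed value. For negative times the integrand is
  -- constantly `u`, so two-sided derivatives are available.
  have h1 : HasDerivAt (fun h : ℝ => F (t + h) - F h) (W.op t u - u) 0 := by
    have e1 : HasDerivAt (fun h : ℝ => F (t + h)) (W.op t u) 0 := by
      have := (hder ((t : ℝ) + 0)).comp_const_add (t : ℝ) 0
      simpa using this
    have e2 := hder 0
    simp only [Real.toNNReal_zero, W.op_zero] at e2
    exact e1.sub e2
  rw [hA]
  have h2 := (hasDerivAt_iff_tendsto_slope.1 h1)
  have h3 : Tendsto (fun h : ℝ≥0 => (h : ℝ)) (𝓝[>] 0) (𝓝[≠] 0) := by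
    refine tendsto_nhdsWithin_iff.2 ⟨?_, ?_⟩
    · exact (NNReal.continuous_coe.tendsto 0).mono_left nhdsWithin_le_nhds
    · filter_upwards [self_mem_nhdsWithin] with h hh
      simpa using (ne_of_gt hh)
  refine (h2.comp h3).congr fun h => ?_
  simp only [Function.comp_apply, slope_def_module, sub_zero, hF, add_zero,
    intervalIntegral.integral_same]
  rw [hshift h, ← Complex.ofReal_inv, Complex.coe_smul]
  congr 1
  have a1 := intervalIntegral.integral_add_adjacent_intervals (hi 0 h) (hi h (t + h))
  rw [← a1]
  abel

/-- The averages `x⁻¹ ∫₀ˣ W_s u ds` lie in the domain and tend to `u` as `x → 0+`. -/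
theorem dense_domain [CompleteSpace H] {A : H →ₗ.[ℂ] H} (hA : W.HasGenerator A) :
    Dense (A.domain : Set H) := by
  intro u
  have hc := W.continuous_op_toNNReal u
  have hder : HasDerivAt (fun x : ℝ => ∫ s in (0 : ℝ)..x, W.op s.toNNReal u)
      (W.op (0 : ℝ).toNNReal u) 0 :=
    intervalIntegral.integral_hasDerivAt_right (hc.intervalIntegrable _ _)
      hc.stronglyMeasurable.stronglyMeasurableAtFilter hc.continuousAt
  have h2 := hasDerivAt_iff_tendsto_slope.1 hder
  have h3 := h2.mono_left (nhdsWithin_mono (0 : ℝ) (fun x (hx : 0 < x) => hx.ne') :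
    𝓝[>] (0 : ℝ) ≤ 𝓝[≠] 0)
  simp only [Real.toNNReal_zero, W.op_zero] at h3
  refine mem_closure_of_tendsto h3 ?_
  filter_upwards [self_mem_nhdsWithin] with x hx
  have h4 := A.mem_domain_of_mem_graph (W.integral_op_mem_graph hA x.toNNReal u)
  rw [Real.coe_toNNReal _ (le_of_lt hx)] at h4
  simp only [slope_def_module, sub_zero, intervalIntegral.integral_same]
  rw [← Complex.coe_smul]
  exact A.domain.smul_mem _ h4

theorem generator_op_apply {A : H →ₗ.[ℂ] H} (hA : W.HasGenerator A) (s : ℝ≥0) (u : A.domain) :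
    A ⟨W.op s u, op_mem_domain hA s u.2⟩ = W.op s (A u) := by
  have h1 := (hA u (A u)).1 (A.mem_graph u)
  have h2 := ((W.op s).continuous.tendsto _).comp h1
  have h3 := (hA _ _).1 (A.mem_graph ⟨W.op s u, op_mem_domain hA s u.2⟩)
  have : (𝓝[>] (0 : ℝ≥0)).NeBot := inferInstance
  refine tendsto_nhds_unique h3 (h2.congr fun t => ?_)
  simp only [Function.comp_apply, map_smul, map_sub]
  rw [← W.op_add_apply, ← W.op_add_apply, add_comm]

/-- The generator is a one-sided limit, so only the right derivative is immediate; the fundamental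
theorem of calculus for right derivatives needs no more. -/
theorem hasDerivWithinAt_op {A : H →ₗ.[ℂ] H} (hA : W.HasGenerator A) {t : ℝ} (ht : 0 ≤ t)
    (u : A.domain) :
    HasDerivWithinAt (fun s : ℝ => W.op s.toNNReal u) (W.op t.toNNReal (A u)) (Ioi t) t := by
  rw [hasDerivWithinAt_iff_tendsto_slope' (by simp)]
  have h1 := (hA _ _).1 (A.mem_graph ⟨W.op t.toNNReal u, op_mem_domain hA _ u.2⟩)
  rw [W.generator_op_apply hA] at h1
  have h2 : Tendsto (fun y : ℝ => (y - t).toNNReal) (𝓝[>] t) (𝓝[>] 0) := by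
    refine tendsto_nhdsWithin_iff.2 ⟨?_, ?_⟩
    · have : Continuous fun y : ℝ => (y - t).toNNReal := by fun_prop
      simpa using (this.tendsto t).mono_left nhdsWithin_le_nhds
    · filter_upwards [self_mem_nhdsWithin] with y hy
      simpa using hy
  refine (h1.comp h2).congr' ?_
  filter_upwards [self_mem_nhdsWithin] with y hy
  have hy' : t < y := hy
  simp only [Function.comp_apply, slope_def_module]
  rw [← W.op_add_apply, ← Real.toNNReal_add (by linarith) ht, sub_add_cancel,
    Real.coe_toNNReal _ (by linarith), ← Complex.ofReal_inv, Complex.coe_smul]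

end ContractionSemigroup

/-! ### Orbits in the domain and the energy balance. -/

namespace FormalGenerator

variable {H : Type*} [NormedAddCommGroup H] [InnerProductSpace ℂ H] [CompleteSpace H]
  (L : FormalGenerator H)

theorem dense_domain : Dense (L.G.domain : Set H) := by
  have h := L.W.dense_domain L.hasGenerator
  exact h

/-- `u ↦ W_s u` as a linear map on `dom G`. -/
def orbitLinear (s : ℝ) : L.G.domain →ₗ[ℂ] L.G.domain where
  toFun := L.orbit s
  map_add' u v := by ext; simp [orbit]
  map_smul' c u := by ext; simp [orbit]

theorem coe_orbit (s : ℝ) (u : L.G.domain) : (L.orbit s u : H) = L.W.op s.toNNReal u := rfl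

theorem G_orbit (s : ℝ) (u : L.G.domain) : L.G (L.orbit s u) = L.W.op s.toNNReal (L.G u) := by
  have h := L.W.generator_op_apply L.hasGenerator s.toNNReal u
  simp only [LinearPMap.neg_apply, map_neg, neg_inj] at h
  exact h

theorem orbit_zero (u : L.G.domain) : L.orbit 0 u = u := by
  ext; simp [coe_orbit, L.W.op_zero]

theorem norm_orbit_le (s : ℝ) (u : L.G.domain) : ‖(L.orbit s u : H)‖ ≤ ‖(u : H)‖ :=
  L.W.norm_op_apply_le _ _

theorem norm_G_orbit_le (s : ℝ) (u : L.G.domain) : ‖L.G (L.orbit s u)‖ ≤ ‖L.G u‖ := by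
  rw [G_orbit]; exact L.W.norm_op_apply_le _ _

theorem continuous_coe_orbit (u : L.G.domain) : Continuous fun s => (L.orbit s u : H) :=
  L.W.continuous_op_toNNReal u

theorem continuous_G_orbit (u : L.G.domain) : Continuous fun s => L.G (L.orbit s u) := by
  simp_rw [G_orbit]; exact L.W.continuous_op_toNNReal _

/-- The energy balance of the contraction semigroup on `dom G`. -/
theorem integral_inner_G_orbit {t : ℝ} (ht : 0 ≤ t) (u v : L.G.domain) :
    ∫ s in (0 : ℝ)..t, (⟪L.G (L.orbit s u), (L.orbit s v : H)⟫_ℂ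
      + ⟪(L.orbit s u : H), L.G (L.orbit s v)⟫_ℂ)
      = ⟪(u : H), v⟫_ℂ - ⟪(L.orbit t u : H), L.orbit t v⟫_ℂ := by
  have hd : ∀ w : L.G.domain, ∀ s : ℝ, 0 ≤ s → HasDerivWithinAt (fun s => (L.orbit s w : H))
      (-L.G (L.orbit s w)) (Ioi s) s := fun w s hs => by
    have h := L.W.hasDerivWithinAt_op L.hasGenerator hs w
    rw [LinearPMap.neg_apply, map_neg] at h
    rw [G_orbit]
    exact h
  have hc := L.continuous_coe_orbit
  have hG := L.continuous_G_orbit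
  have h := intervalIntegral.integral_eq_sub_of_hasDeriv_right (a := 0) (b := t)
    (f := fun s => ⟪(L.orbit s u : H), (L.orbit s v : H)⟫_ℂ)
    (f' := fun s => ⟪(L.orbit s u : H), -L.G (L.orbit s v)⟫_ℂ
      + ⟪-L.G (L.orbit s u), (L.orbit s v : H)⟫_ℂ)
    ((hc u).inner (hc v)).continuousOn (fun s hs => by
      rw [min_eq_left ht] at hs
      exact (hd u s hs.1.le).inner ℂ (hd v s hs.1.le))
    (Continuous.intervalIntegrable (((hc u).inner (hG v).neg).add ((hG u).neg.inner (hc v))) _ _)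
  rw [L.orbit_zero, L.orbit_zero] at h
  rw [← neg_sub, ← h, ← intervalIntegral.integral_neg]
  refine intervalIntegral.integral_congr fun s _ => ?_
  simp only [inner_neg_left, inner_neg_right]
  ring

end FormalGenerator

/-! ### Finite-rank projections increasing to the identity. -/

section HilbertBasis

variable {H : Type*} [NormedAddCommGroup H] [InnerProductSpace ℂ H] {ι : Type*}
  (b : HilbertBasis ι ℂ H)

/-- The projection onto the span of finitely many vectors of a Hilbert basis. -/
noncomputable def basisProj (s : Finset ι) : H →L[ℂ] H := ∑ i ∈ s, InnerProductSpace.rankOne ℂ (b i) (b i)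

theorem basisProj_mono [CompleteSpace H] : Monotone (basisProj b) := fun s t hst => by
  rw [← sub_nonneg, basisProj, basisProj]
  classical
  rw [← Finset.sum_sdiff hst, add_sub_cancel_right]
  exact Finset.sum_nonneg fun i _ =>
    (ContinuousLinearMap.nonneg_iff_isPositive _).2 (InnerProductSpace.isPositive_rankOne_self _)

theorem basisProj_nonneg [CompleteSpace H] (s : Finset ι) : 0 ≤ basisProj b s := by
  simpa [basisProj] using basisProj_mono b (Finset.empty_subset s)

theorem tendsto_basisProj (u : H) : Tendsto (fun s => basisProj b s u) atTop (𝓝 u) := by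
  have h := b.hasSum_repr u
  refine h.congr fun s => ?_
  simp [basisProj, HilbertBasis.repr_apply_apply]

theorem basisProj_mul_self (s : Finset ι) : basisProj b s * basisProj b s = basisProj b s := by
  classical
  have ho := orthonormal_iff_ite.1 b.orthonormal
  ext u
  simp only [basisProj, mul_apply_eq_comp, sum_apply,
    InnerProductSpace.rankOne_apply, inner_sum, inner_smul_right, ho]
  refine Finset.sum_congr rfl fun i hi => ?_
  simp [hi]

theorem isLUB_basisProj [CompleteSpace H] : IsLUB (range (basisProj b)) 1 := by
  constructor
  · rintro _ ⟨s, rfl⟩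
    refine (operator_le_iff _ _).2 fun u => ?_
    have h : Tendsto (fun t => ⟪u, basisProj b t u⟫_ℂ) atTop (𝓝 ⟪u, (1 : H →L[ℂ] H) u⟫_ℂ) :=
      tendsto_const_nhds.inner (tendsto_basisProj b u)
    refine ge_of_tendsto h ?_
    filter_upwards [eventually_ge_atTop s] with t ht
    exact (operator_le_iff _ _).1 (basisProj_mono b ht) u
  · intro a ha
    refine (operator_le_iff _ _).2 fun u => ?_
    have h : Tendsto (fun t => ⟪u, basisProj b t u⟫_ℂ) atTop (𝓝 ⟪u, (1 : H →L[ℂ] H) u⟫_ℂ) :=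
      tendsto_const_nhds.inner (tendsto_basisProj b u)
    exact le_of_tendsto h (Eventually.of_forall fun t => (operator_le_iff _ _).1 (ha ⟨t, rfl⟩) u)

theorem star_basisProj [CompleteSpace H] (s : Finset ι) : star (basisProj b s) = basisProj b s :=
  (IsSelfAdjoint.of_nonneg (basisProj_nonneg b s)).star_eq

theorem norm_basisProj_le [CompleteSpace H] (s : Finset ι) : ‖basisProj b s‖ ≤ 1 := by
  refine (CStarAlgebra.norm_le_norm_of_nonneg_of_le (basisProj_nonneg b s)
    ((isLUB_basisProj b).1 ⟨s, rfl⟩)).trans ?_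
  exact ContinuousLinearMap.norm_id_le

end HilbertBasis

universe u

/-! ### Cauchy-Schwarz bounds and weak continuity of the map `φ`. -/

namespace FormalGenerator

variable {H : Type u} [NormedAddCommGroup H] [InnerProductSpace ℂ H] [CompleteSpace H]
  (L : FormalGenerator H)

theorem phi_star_mul_self_nonneg (a : H →L[ℂ] H) (u : L.G.domain) :
    0 ≤ L.phi (star a * a) u u := by
  simpa using L.completelyPositive 1 (fun _ => u) (fun _ => a)

theorem phi_nonneg {x : H →L[ℂ] H} (hx : 0 ≤ x) (u : L.G.domain) : 0 ≤ L.phi x u u := by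
  obtain ⟨b, rfl⟩ := CStarAlgebra.nonneg_iff_eq_star_mul_self.1 hx
  exact L.phi_star_mul_self_nonneg b u

theorem phi_mono {x y : H →L[ℂ] H} (hxy : x ≤ y) (u : L.G.domain) :
    L.phi x u u ≤ L.phi y u u := by
  have h := L.phi_nonneg (sub_nonneg.2 hxy) u
  simpa [sub_nonneg] using h

theorem phi_pair_nonneg (a b : H →L[ℂ] H) (u v : L.G.domain) :
    0 ≤ L.phi (star a * a) u u + L.phi (star a * b) u v + (L.phi (star b * a) v u
      + L.phi (star b * b) v v) := by
  simpa [Fin.sum_univ_two] using L.completelyPositive 2 ![u, v] ![a, b]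

/-- The sum in `phi_pair_nonneg` is real. Taking it at `u` and at `i u` fixes the imaginary and the
real part of the relation between the two cross terms. -/
theorem phi_star_mul_comm (a b : H →L[ℂ] H) (u v : L.G.domain) :
    L.phi (star b * a) v u = starRingEnd ℂ (L.phi (star a * b) u v) := by
  have ha := (Complex.nonneg_iff.1 (L.phi_star_mul_self_nonneg a u)).2
  have hb := (Complex.nonneg_iff.1 (L.phi_star_mul_self_nonneg b v)).2
  have h1 := (Complex.nonneg_iff.1 (L.phi_pair_nonneg a b u v)).2
  have h2 := (Complex.nonneg_iff.1 (L.phi_pair_nonneg a b (Complex.I • u) v)).2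
  simp only [map_smulₛₗ, LinearMap.smul_apply, Complex.conj_I, RingHom.id_apply,
    smul_eq_mul, Complex.add_im, Complex.mul_im, Complex.neg_re, Complex.neg_im, Complex.I_re,
    Complex.I_im, Complex.mul_re] at h1 h2
  apply Complex.ext
  · simp only [Complex.conj_re]; linarith
  · simp only [Complex.conj_im]; linarith

theorem norm_phi_star_mul_le (a b : H →L[ℂ] H) (u v : L.G.domain) :
    ‖L.phi (star a * b) u v‖ ≤
      ((L.phi (star a * a) u u).re + (L.phi (star b * b) v v).re) / 2 := by
  set z := L.phi (star a * b) u v with hz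
  rcases eq_or_ne z 0 with h0 | h0
  · rw [h0, norm_zero]
    have ha := (Complex.nonneg_iff.1 (L.phi_star_mul_self_nonneg a u)).1
    have hb := (Complex.nonneg_iff.1 (L.phi_star_mul_self_nonneg b v)).1
    positivity
  have hn : 0 < ‖z‖ := norm_pos_iff.2 h0
  -- This phase makes each of the two cross terms equal to `-‖z‖`, so positivity becomes the desired
  -- bound.
  set c : ℂ := -(z / ‖z‖) with hc
  have hcz : starRingEnd ℂ c * z = -‖z‖ := by
    have hn' : (‖z‖ : ℂ) ≠ 0 := by exact_mod_cast hn.ne'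
    rw [hc, map_neg, map_div₀, Complex.conj_ofReal, neg_mul, div_mul_eq_mul_div, mul_comm,
      Complex.mul_conj, Complex.normSq_eq_norm_sq]
    push_cast
    field_simp
  have hcc : starRingEnd ℂ c * c = 1 := by
    rw [mul_comm, Complex.mul_conj, Complex.normSq_eq_norm_sq, hc, norm_neg, norm_div]
    simp [hn.ne']
  have h := (Complex.nonneg_iff.1 (L.phi_pair_nonneg a b (c • u) v)).1
  simp only [map_smulₛₗ, LinearMap.smul_apply, RingHom.id_apply, smul_eq_mul] at h
  rw [L.phi_star_mul_comm a b u v, ← hz] at h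
  have e1 : c * starRingEnd ℂ z = -‖z‖ := by
    have := congrArg (starRingEnd ℂ) hcz
    simpa using this
  rw [hcz, e1, ← mul_assoc, mul_comm c, hcc, one_mul] at h
  simp only [Complex.add_re, Complex.neg_re, Complex.ofReal_re] at h
  linarith

theorem norm_phi_star_mul_le_sqrt (a b : H →L[ℂ] H) (u v : L.G.domain) :
    ‖L.phi (star a * b) u v‖ ≤
      √(L.phi (star a * a) u u).re * √(L.phi (star b * b) v v).re := by
  set A := (L.phi (star a * a) u u).re
  set B := (L.phi (star b * b) v v).re
  have hA : 0 ≤ A := (Complex.nonneg_iff.1 (L.phi_star_mul_self_nonneg a u)).1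
  have hB : 0 ≤ B := (Complex.nonneg_iff.1 (L.phi_star_mul_self_nonneg b v)).1
  have key : ∀ s t : ℝ, 0 < s → 0 < t →
      s * t * ‖L.phi (star a * b) u v‖ ≤ (s ^ 2 * A + t ^ 2 * B) / 2 := fun s t hs ht => by
    have h := L.norm_phi_star_mul_le a b ((s : ℂ) • u) ((t : ℂ) • v)
    simp only [map_smulₛₗ, LinearMap.smul_apply, RingHom.id_apply, smul_eq_mul,
      Complex.conj_ofReal, norm_mul, Complex.norm_real, Real.norm_eq_abs, abs_of_pos hs,
      abs_of_pos ht, Complex.re_ofReal_mul] at h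
    calc _ = _ := by ring
      _ ≤ _ := h
      _ = _ := by ring
  refine le_of_forall_pos_le_add fun ε hε => ?_
  have h1 : Tendsto (fun δ : ℝ => (√A + δ) * (√B + δ)) (𝓝[>] 0) (𝓝 (√A * √B)) := by
    have : Continuous (fun δ : ℝ => (√A + δ) * (√B + δ)) := by fun_prop
    simpa using (this.tendsto 0).mono_left nhdsWithin_le_nhds
  obtain ⟨δ, h2, hδ⟩ := ((h1.eventually_lt_const (lt_add_of_pos_right _ hε)).and
    self_mem_nhdsWithin).exists
  refine le_trans ?_ h2.le
  have hδ' : 0 < δ := hδ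
  have hs : 0 < √A + δ := by positivity
  have ht : 0 < √B + δ := by positivity
  -- These weights balance the two terms of the additive bound; `δ > 0` keeps them nonzero when `A`
  -- or `B` vanishes.
  have h3 := key (√B + δ) (√A + δ) ht hs
  have hA' : A ≤ (√A + δ) ^ 2 := by nlinarith [Real.sq_sqrt hA, Real.sqrt_nonneg A]
  have hB' : B ≤ (√B + δ) ^ 2 := by nlinarith [Real.sq_sqrt hB, Real.sqrt_nonneg B]
  have h4 : (√B + δ) * (√A + δ) * ‖L.phi (star a * b) u v‖ ≤
      (√B + δ) * (√A + δ) * ((√A + δ) * (√B + δ)) := by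
    refine h3.trans ?_
    have := mul_le_mul_of_nonneg_left hA' (sq_nonneg (√B + δ))
    have := mul_le_mul_of_nonneg_left hB' (sq_nonneg (√A + δ))
    nlinarith
  exact le_of_mul_le_mul_left h4 (by positivity)

/-- The quadratic form `φ(I)[u]`. -/
def phiOne (u : L.G.domain) : ℝ := (L.phi 1 u u).re

theorem phiOne_nonneg (u : L.G.domain) : 0 ≤ L.phiOne u :=
  (Complex.nonneg_iff.1 (L.phi_nonneg zero_le_one u)).1

theorem phi_one_eq (u : L.G.domain) : L.phi 1 u u = (L.phiOne u : ℂ) :=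
  (Complex.eq_re_of_ofReal_le (r := 0) (by simpa using L.phi_nonneg zero_le_one u))

theorem phi_star_mul_self_le (x : H →L[ℂ] H) (u : L.G.domain) :
    (L.phi (star x * x) u u).re ≤ ‖x‖ ^ 2 * L.phiOne u := by
  have h := L.phi_mono (CStarAlgebra.star_mul_le_algebraMap_norm_sq (a := x)) u
  have e : (algebraMap ℝ (H →L[ℂ] H)) (‖x‖ ^ 2) = ((‖x‖ ^ 2 : ℝ) : ℂ) • 1 := by
    rw [Algebra.algebraMap_eq_smul_one, Complex.coe_smul]
  rw [e] at h
  have := (Complex.le_def.1 h).1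
  rw [map_smul, LinearMap.smul_apply, LinearMap.smul_apply, smul_eq_mul,
    Complex.re_ofReal_mul] at this
  exact this

/-- Writing `x = 1* x` in Cauchy-Schwarz leaves `φ(x* x)[v]`, which `x* x ≤ ‖x‖² I` controls. -/
theorem norm_phi_le_sqrt (x : H →L[ℂ] H) (u v : L.G.domain) :
    ‖L.phi x u v‖ ≤ ‖x‖ * (√(L.phiOne u) * √(L.phiOne v)) := by
  have h := L.norm_phi_star_mul_le_sqrt 1 x u v
  rw [star_one, one_mul, one_mul] at h
  refine h.trans ?_
  have h2 : √(L.phi (star x * x) v v).re ≤ ‖x‖ * √(L.phiOne v) := by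
    refine (Real.sqrt_le_sqrt (L.phi_star_mul_self_le x v)).trans ?_
    rw [Real.sqrt_mul (sq_nonneg _), Real.sqrt_sq (norm_nonneg _)]
  calc _ ≤ √(L.phiOne u) * (‖x‖ * √(L.phiOne v)) := by
        gcongr
        exact le_refl _
    _ = _ := by ring

theorem norm_phi_le (x : H →L[ℂ] H) (u v : L.G.domain) :
    ‖L.phi x u v‖ ≤ ‖x‖ / 2 * (L.phiOne u + L.phiOne v) := by
  refine (L.norm_phi_le_sqrt x u v).trans ?_
  have h : √(L.phiOne u) * √(L.phiOne v) ≤ (L.phiOne u + L.phiOne v) / 2 := by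
    nlinarith [sq_nonneg (√(L.phiOne u) - √(L.phiOne v)), Real.sq_sqrt (L.phiOne_nonneg u),
      Real.sq_sqrt (L.phiOne_nonneg v)]
  calc _ ≤ ‖x‖ * ((L.phiOne u + L.phiOne v) / 2) := by gcongr
    _ = _ := by ring

theorem phiOne_le_inner (u : L.G.domain) :
    (L.phiOne u : ℂ) ≤ ⟪L.G u, (u : H)⟫_ℂ + ⟪(u : H), L.G u⟫_ℂ := by
  have h := L.generatorForm_one_nonpos u
  rw [generatorForm, L.phi_one_eq, sub_sub, sub_nonpos] at h
  simpa using h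

theorem phiOne_le (u : L.G.domain) : L.phiOne u ≤ 2 * (‖L.G u‖ * ‖(u : H)‖) := by
  have h := (Complex.le_def.1 (L.phiOne_le_inner u)).1
  rw [Complex.ofReal_re] at h
  have h1 := (Complex.re_le_norm _).trans
    (norm_add_le ⟪L.G u, (u : H)⟫_ℂ ⟪(u : H), L.G u⟫_ℂ)
  have h2 := norm_inner_le_norm (𝕜 := ℂ) (L.G u) (u : H)
  have h3 := norm_inner_le_norm (𝕜 := ℂ) (u : H) (L.G u)
  nlinarith

/-- The graph norm of `G`. -/
def graphNorm (u : L.G.domain) : ℝ := ‖(u : H)‖ + ‖L.G u‖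

theorem graphNorm_nonneg (u : L.G.domain) : 0 ≤ L.graphNorm u := by
  unfold graphNorm; positivity

/-- Unlike `φ(I)[u]`, the graph norm is subadditive and does not increase along orbits, which gives
continuity estimates and integrable majorants uniform over bounded `x`. -/
theorem norm_phi_le_graphNorm (x : H →L[ℂ] H) (u v : L.G.domain) :
    ‖L.phi x u v‖ ≤ ‖x‖ * (L.graphNorm u * L.graphNorm v) := by
  have h : ∀ w, √(L.phiOne w) ≤ L.graphNorm w := fun w => by
    rw [Real.sqrt_le_left (L.graphNorm_nonneg w)]
    refine (L.phiOne_le w).trans ?_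
    unfold graphNorm
    nlinarith [sq_nonneg ‖(w : H)‖, sq_nonneg ‖L.G w‖]
  refine (L.norm_phi_le_sqrt x u v).trans ?_
  have := L.graphNorm_nonneg u
  gcongr <;> exact h _

theorem graphNorm_orbit_le (s : ℝ) (u : L.G.domain) :
    L.graphNorm (L.orbit s u) ≤ L.graphNorm u :=
  add_le_add (L.norm_orbit_le s u) (L.norm_G_orbit_le s u)

theorem norm_phi_orbit_le (x : H →L[ℂ] H) (s : ℝ) (u v : L.G.domain) :
    ‖L.phi x (L.orbit s u) (L.orbit s v)‖ ≤ ‖x‖ * (L.graphNorm u * L.graphNorm v) := by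
  refine (L.norm_phi_le_graphNorm _ _ _).trans ?_
  have := L.graphNorm_nonneg (L.orbit s v)
  have := L.graphNorm_nonneg u
  gcongr <;> exact L.graphNorm_orbit_le _ _

/-! ### Normality -/

section Normality

variable {ι : Type*} (b : HilbertBasis ι ℂ H)

/-- This is the point where normality enters, applied to the projections increasing to the identity.
-/
theorem tendsto_phi_one_sub_basisProj (u : L.G.domain) :
    Tendsto (fun s => (L.phi (1 - basisProj b s) u u).re) atTop (𝓝 0) := by
  have h := L.normal u (range (basisProj b)) 1 ⟨_, ⟨∅, rfl⟩⟩
    (directedOn_range.2 (basisProj_mono b).directed_le)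
    (by rintro _ ⟨s, rfl⟩; exact basisProj_nonneg b s) (isLUB_basisProj b)
  rw [← range_comp] at h
  have hm : Monotone ((fun x => (L.phi x u u).re) ∘ basisProj b) := fun s t hst =>
    (Complex.le_def.1 (L.phi_mono (basisProj_mono b hst) u)).1
  have h1 := tendsto_atTop_isLUB hm h
  have h2 := h1.const_sub (L.phi 1 u u).re
  rw [sub_self] at h2
  refine h2.congr fun s => ?_
  simp

theorem norm_phi_sub_compression_le (s : Finset ι) (x : H →L[ℂ] H) (u v : L.G.domain) :
    ‖L.phi x u v - L.phi (basisProj b s * x * basisProj b s) u v‖ ≤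
      ‖x‖ * (√(L.phi (1 - basisProj b s) u u).re * √(L.phiOne v) +
        √(L.phiOne u) * √(L.phi (1 - basisProj b s) v v).re) := by
  set p := basisProj b s with hp
  have hs : star p = p := star_basisProj b s
  have hpp : p * p = p := basisProj_mul_self b s
  have hq : star (1 - p) * (1 - p) = 1 - p := by
    rw [star_sub, star_one, hs, mul_sub, sub_mul, sub_mul, hpp]; simp
  have hsq : star (1 - p) = 1 - p := by rw [star_sub, star_one, hs]
  -- Each of the two terms has a factor `1 - p` on the outside, which Cauchy-Schwarz turns into the
  -- small quantity `φ(1 - p)`.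
  have e : x - p * x * p = star (1 - p) * x + star (star (p * x)) * (1 - p) := by
    rw [hsq, star_star]; noncomm_ring
  rw [← LinearMap.sub_apply, ← LinearMap.sub_apply, ← map_sub, e, map_add, LinearMap.add_apply,
    LinearMap.add_apply]
  refine (norm_add_le _ _).trans ?_
  have hb : ∀ (y : H →L[ℂ] H) (w : L.G.domain), ‖y‖ ≤ ‖x‖ →
      √(L.phi (star y * y) w w).re ≤ ‖x‖ * √(L.phiOne w) := fun y w hy => by
    refine (Real.sqrt_le_sqrt (L.phi_star_mul_self_le y w)).trans ?_
    rw [Real.sqrt_mul (sq_nonneg _), Real.sqrt_sq (norm_nonneg _)]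
    gcongr
  have h1 := L.norm_phi_star_mul_le_sqrt (1 - p) x u v
  have h2 := L.norm_phi_star_mul_le_sqrt (star (p * x)) (1 - p) u v
  rw [hq] at h1 h2
  have hpx : ‖star (p * x)‖ ≤ ‖x‖ := by
    rw [norm_star]
    refine (norm_mul_le _ _).trans ?_
    nlinarith [norm_basisProj_le b s, norm_nonneg x]
  have h3 := hb x v le_rfl
  have h4 := hb _ u hpx
  calc _ ≤ _ := add_le_add h1 h2
    _ ≤ √(L.phi (1 - p) u u).re * (‖x‖ * √(L.phiOne v)) +
        (‖x‖ * √(L.phiOne u)) * √(L.phi (1 - p) v v).re := by gcongr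
    _ = _ := by ring

theorem phi_compression (s : Finset ι) (x : H →L[ℂ] H) (u v : L.G.domain) :
    L.phi (basisProj b s * x * basisProj b s) u v =
      ∑ i ∈ s, ∑ j ∈ s, L.phi (InnerProductSpace.rankOne ℂ (b i) (b j)) u v
        * ⟪b i, x (b j)⟫_ℂ := by
  have e : basisProj b s * x * basisProj b s =
      ∑ i ∈ s, ∑ j ∈ s, ⟪b i, x (b j)⟫_ℂ • InnerProductSpace.rankOne ℂ (b i) (b j) := by
    ext w
    simp only [basisProj, mul_apply_eq_comp, sum_apply,
      InnerProductSpace.rankOne_apply, map_sum, map_smul, smul_apply, Finset.smul_sum]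
    rw [Finset.sum_comm]
    refine Finset.sum_congr rfl fun i _ => Finset.sum_congr rfl fun j _ => ?_
    rw [smul_smul, smul_smul, mul_comm]
  rw [e]
  simp only [map_sum, map_smul, LinearMap.sum_apply, LinearMap.smul_apply, smul_eq_mul]
  exact Finset.sum_congr rfl fun i _ => Finset.sum_congr rfl fun j _ => mul_comm _ _

end Normality

/-- On bounded sets, `φ(·)[u, v]` is a uniform limit of combinations of matrix coefficients. -/
theorem exists_matrix_approximation (u v : L.G.domain) {ε : ℝ} (hε : 0 < ε) :
    ∃ (ι : Type u) (s : Finset ι) (e f : ι → H) (c : ι → ℂ), ∀ x : H →L[ℂ] H,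
      ‖L.phi x u v - ∑ i ∈ s, c i * ⟪e i, x (f i)⟫_ℂ‖ ≤ ‖x‖ * ε := by
  obtain ⟨w, b, -⟩ := exists_hilbertBasis ℂ H
  have h : Tendsto (fun s => √(L.phi (1 - basisProj b s) u u).re * √(L.phiOne v) +
        √(L.phiOne u) * √(L.phi (1 - basisProj b s) v v).re) atTop (𝓝 0) := by
    have hu := (Real.continuous_sqrt.tendsto _).comp (L.tendsto_phi_one_sub_basisProj b u)
    have hv := (Real.continuous_sqrt.tendsto _).comp (L.tendsto_phi_one_sub_basisProj b v)
    simpa [Function.comp_def] using (hu.mul_const (√(L.phiOne v))).add (hv.const_mul (√(L.phiOne u)))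
  obtain ⟨s, hs⟩ := (h.eventually_lt_const hε).exists
  refine ⟨w × w, s ×ˢ s, fun p => b p.1, fun p => b p.2,
    fun p => L.phi (InnerProductSpace.rankOne ℂ (b p.1) (b p.2)) u v, fun x => ?_⟩
  rw [Finset.sum_product, ← L.phi_compression b s x u v]
  exact (L.norm_phi_sub_compression_le b s x u v).trans (by gcongr)

/-- `φ(·)[u, v]` is continuous on bounded sets for the weak operator topology. -/
theorem tendsto_phi_of_weakTendsto {κ : Type*} {l : Filter κ} {x : κ → H →L[ℂ] H}
    {a : H →L[ℂ] H} {C : ℝ} (hx : ∀ i, ‖x i‖ ≤ C) (h : WeakTendsto x l a) (u v : L.G.domain) :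
    Tendsto (fun i => L.phi (x i) u v) l (𝓝 (L.phi a u v)) := by
  rcases l.eq_or_neBot with rfl | hl
  · exact tendsto_bot
  obtain ⟨i0⟩ : Nonempty κ := NeBot.nonempty l
  have hC : 0 ≤ C := (norm_nonneg _).trans (hx i0)
  rw [Metric.tendsto_nhds]
  intro ε hε
  -- The error is at most `ε / 4` at `x i` and at `a`, which leaves `ε / 2` for the matrix
  -- coefficients.
  obtain ⟨ι, s, e, f, c, hs⟩ := L.exists_matrix_approximation u v
    (ε := ε / (4 * (C + 1))) (by positivity)
  have h1 : Tendsto (fun i => ∑ k ∈ s, c k * ⟪e k, x i (f k)⟫_ℂ) l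
      (𝓝 (∑ k ∈ s, c k * ⟪e k, a (f k)⟫_ℂ)) :=
    tendsto_finsetSum _ fun k _ => (h _ _).const_mul _
  have hsmall : ∀ y : H →L[ℂ] H, ‖y‖ ≤ C → ‖y‖ * (ε / (4 * (C + 1))) ≤ ε / 4 := fun y hy => by
    have h0 : 0 < C + 1 := by positivity
    calc _ ≤ (C + 1) * (ε / (4 * (C + 1))) := by gcongr; linarith
      _ = _ := by field_simp
  filter_upwards [Metric.tendsto_nhds.1 h1 (ε / 2) (half_pos hε)] with i hi
  have a1 := (hs (x i)).trans (hsmall _ (hx i))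
  have a2 := (hs a).trans (hsmall _ (h.norm_le hx))
  rw [dist_eq_norm] at hi ⊢
  rw [norm_sub_rev] at a2
  calc _ = ‖(L.phi (x i) u v - ∑ k ∈ s, c k * ⟪e k, x i (f k)⟫_ℂ)
        + (∑ k ∈ s, c k * ⟪e k, x i (f k)⟫_ℂ - ∑ k ∈ s, c k * ⟪e k, a (f k)⟫_ℂ)
        + (∑ k ∈ s, c k * ⟪e k, a (f k)⟫_ℂ - L.phi a u v)‖ := by congr 1; ring
    _ ≤ _ := norm_add₃_le
    _ < ε := by linarith

/-- Joint continuity of `φ(x)[u, v]`: weakly in bounded `x`, in graph norm in `u` and `v`. -/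
theorem tendsto_phi {κ : Type*} {l : Filter κ} {x : κ → H →L[ℂ] H}
    {a : H →L[ℂ] H} {C : ℝ} (hx : ∀ i, ‖x i‖ ≤ C) (h : WeakTendsto x l a)
    {u v : κ → L.G.domain} {u₀ v₀ : L.G.domain}
    (hu : Tendsto (fun i => (u i : H)) l (𝓝 u₀)) (hGu : Tendsto (fun i => L.G (u i)) l (𝓝 (L.G u₀)))
    (hv : Tendsto (fun i => (v i : H)) l (𝓝 v₀))
    (hGv : Tendsto (fun i => L.G (v i)) l (𝓝 (L.G v₀))) :
    Tendsto (fun i => L.phi (x i) (u i) (v i)) l (𝓝 (L.phi a u₀ v₀)) := by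
  have hN : ∀ {w : κ → L.G.domain} {w₀ : L.G.domain}, Tendsto (fun i => (w i : H)) l (𝓝 w₀) →
      Tendsto (fun i => L.G (w i)) l (𝓝 (L.G w₀)) →
      Tendsto (fun i => L.graphNorm (w i - w₀)) l (𝓝 0) := fun {w w₀} h1 h2 => by
    have := (tendsto_iff_norm_sub_tendsto_zero.1 h1).add (tendsto_iff_norm_sub_tendsto_zero.1 h2)
    simpa [graphNorm, L.G.map_sub] using this
  have hNv : Tendsto (fun i => L.graphNorm (v i)) l (𝓝 (L.graphNorm v₀)) := hv.norm.add hGv.norm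
  have h1 : Tendsto (fun i => L.phi (x i) (u i - u₀) (v i)) l (𝓝 0) := by
    refine squeeze_zero_norm (a := fun i => C * (L.graphNorm (u i - u₀) * L.graphNorm (v i)))
      (fun i => (L.norm_phi_le_graphNorm _ _ _).trans ?_) ?_
    · exact mul_le_mul_of_nonneg_right (hx i)
        (mul_nonneg (L.graphNorm_nonneg _) (L.graphNorm_nonneg _))
    · simpa using ((hN hu hGu).mul hNv).const_mul C
  have h2 : Tendsto (fun i => L.phi (x i) u₀ (v i - v₀)) l (𝓝 0) := by
    refine squeeze_zero_norm (a := fun i => C * (L.graphNorm u₀ * L.graphNorm (v i - v₀)))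
      (fun i => (L.norm_phi_le_graphNorm _ _ _).trans ?_) ?_
    · exact mul_le_mul_of_nonneg_right (hx i)
        (mul_nonneg (L.graphNorm_nonneg _) (L.graphNorm_nonneg _))
    · simpa using ((hN hv hGv).const_mul (L.graphNorm u₀)).const_mul C
  have h3 := (h1.add h2).add (L.tendsto_phi_of_weakTendsto hx h u₀ v₀)
  rw [zero_add, zero_add] at h3
  refine h3.congr fun i => ?_
  simp

/-- `φ(·)[u, v]` commutes with weak integrals of bounded families. -/
theorem integral_mul_phi {α : Type*} [MeasurableSpace α] {μ : Measure α} {g : α → ℂ}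
    {x : α → H →L[ℂ] H} {a : H →L[ℂ] H} {C : ℝ} (hx : ∀ t, ‖x t‖ ≤ C) (hg : Integrable g μ)
    (hi : ∀ u v : H, Integrable (fun t => g t * ⟪u, x t v⟫_ℂ) μ)
    (ha : ∀ u v : H, ∫ t, g t * ⟪u, x t v⟫_ℂ ∂μ = ⟪u, a v⟫_ℂ) (u v : L.G.domain)
    (hphi : Integrable (fun t => g t * L.phi (x t) u v) μ) :
    ∫ t, g t * L.phi (x t) u v ∂μ = L.phi a u v := by
  -- The index type may be empty, so `C` itself need not be nonnegative.
  have hC : 0 ≤ |C| := abs_nonneg C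
  set K := |C| * (∫ t, ‖g t‖ ∂μ) + ‖a‖ with hK
  have hK0 : 0 ≤ K := by positivity
  rw [← sub_eq_zero, ← norm_le_zero_iff]
  refine le_of_forall_pos_le_add fun ε hε => ?_
  rw [zero_add]
  obtain ⟨ι, s, e, f, c, hs⟩ := L.exists_matrix_approximation u v
    (ε := ε / (K + 1)) (by positivity)
  set δ := ε / (K + 1) with hδ
  have hδ0 : 0 ≤ δ := by positivity
  have hsum : ∀ t, g t * ∑ k ∈ s, c k * ⟪e k, x t (f k)⟫_ℂ
      = ∑ k ∈ s, c k * (g t * ⟪e k, x t (f k)⟫_ℂ) := fun t => by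
    rw [Finset.mul_sum]; exact Finset.sum_congr rfl fun k _ => by ring
  have hint : Integrable (fun t => g t * ∑ k ∈ s, c k * ⟪e k, x t (f k)⟫_ℂ) μ := by
    simp_rw [hsum]
    exact integrable_finsetSum _ fun k _ => (hi _ _).const_mul _
  have e1 : ∫ t, g t * ∑ k ∈ s, c k * ⟪e k, x t (f k)⟫_ℂ ∂μ = ∑ k ∈ s, c k * ⟪e k, a (f k)⟫_ℂ := by
    simp_rw [hsum]
    rw [integral_finsetSum _ fun k _ => (hi _ _).const_mul _]
    simp_rw [integral_const_mul, ha]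
  have e2 : ∫ t, g t * L.phi (x t) u v ∂μ - L.phi a u v =
      (∫ t, (g t * L.phi (x t) u v - g t * ∑ k ∈ s, c k * ⟪e k, x t (f k)⟫_ℂ) ∂μ)
        - (L.phi a u v - ∑ k ∈ s, c k * ⟪e k, a (f k)⟫_ℂ) := by
    rw [integral_sub hphi hint, e1]; ring
  rw [e2]
  refine (norm_sub_le _ _).trans ?_
  have b1 : ‖∫ t, (g t * L.phi (x t) u v - g t * ∑ k ∈ s, c k * ⟪e k, x t (f k)⟫_ℂ) ∂μ‖
      ≤ ∫ t, |C| * δ * ‖g t‖ ∂μ := by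
    refine norm_integral_le_of_norm_le (hg.norm.const_mul _) (Eventually.of_forall fun t => ?_)
    rw [← mul_sub, norm_mul]
    have := (hs (x t)).trans (mul_le_mul_of_nonneg_right ((hx t).trans (le_abs_self C)) hδ0)
    rw [mul_comm]
    gcongr
  rw [integral_const_mul] at b1
  calc _ ≤ |C| * δ * (∫ t, ‖g t‖ ∂μ) + ‖a‖ * δ := add_le_add b1 (hs a)
    _ = K * δ := by rw [hK]; ring
    _ ≤ (K + 1) * δ := by gcongr; linarith
    _ = ε := by rw [hδ]; field_simp

end FormalGenerator

/-- A norm bounded family of operators that is continuous in the weak operator topology. -/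
structure IsWeakFamily {H : Type*} [NormedAddCommGroup H] [InnerProductSpace ℂ H]
    (p : ℝ≥0 → H →L[ℂ] H) (C : ℝ) : Prop where
  norm_le : ∀ t, ‖p t‖ ≤ C
  weakTendsto : ∀ t₀, WeakTendsto p (𝓝 t₀) (p t₀)

namespace IsWeakFamily

variable {H : Type*} [NormedAddCommGroup H] [InnerProductSpace ℂ H]
  {p : ℝ≥0 → H →L[ℂ] H} {C : ℝ}

theorem nonneg (hp : IsWeakFamily p C) : 0 ≤ C := (norm_nonneg _).trans (hp.norm_le 0)

theorem continuous (hp : IsWeakFamily p C) (u v : H) :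
    Continuous fun t => ⟪u, p t v⟫_ℂ :=
  continuous_iff_continuousAt.2 fun t₀ => hp.weakTendsto t₀ u v

theorem const (a : H →L[ℂ] H) : IsWeakFamily (fun _ => a) ‖a‖ :=
  ⟨fun _ => le_rfl, fun _ _ _ => tendsto_const_nhds⟩

end IsWeakFamily

theorem Complex.intervalIntegral_nonneg {f : ℝ → ℂ} {a b : ℝ} (hab : a ≤ b)
    (hf : ∀ t, 0 ≤ f t) : 0 ≤ ∫ t in a..b, f t := by
  rw [intervalIntegral.integral_of_le hab]
  exact integral_nonneg hf

/-! ### The iterates and the minimal semigroup. -/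

namespace FormalGenerator

variable {H : Type*} [NormedAddCommGroup H] [InnerProductSpace ℂ H] [CompleteSpace H]
  (L : FormalGenerator H)

/-- The time of the operator family and the time of the orbit vary independently, to serve both the
convolution integrand and the double integral in Fubini's theorem. -/
theorem continuous_phi_orbit {p : ℝ≥0 → H →L[ℂ] H} {C : ℝ} (hp : IsWeakFamily p C)
    (u v : L.G.domain) :
    Continuous fun z : ℝ × ℝ => L.phi (p z.1.toNNReal) (L.orbit z.2 u) (L.orbit z.2 v) := by
  refine continuous_iff_continuousAt.2 fun z₀ => ?_
  refine L.tendsto_phi (x := fun z : ℝ × ℝ => p z.1.toNNReal) (C := C) (fun z => hp.norm_le _)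
    (fun a b => ?_) ?_ ?_ ?_ ?_
  · have h : Continuous fun z : ℝ × ℝ => ⟪a, p z.1.toNNReal b⟫_ℂ :=
      (hp.continuous a b).comp (continuous_real_toNNReal.comp continuous_fst)
    exact h.tendsto z₀
  · exact ((L.continuous_coe_orbit u).comp continuous_snd).tendsto z₀
  · exact ((L.continuous_G_orbit u).comp continuous_snd).tendsto z₀
  · exact ((L.continuous_coe_orbit v).comp continuous_snd).tendsto z₀
  · exact ((L.continuous_G_orbit v).comp continuous_snd).tendsto z₀

theorem continuous_phi_const_orbit (x : H →L[ℂ] H) (u v : L.G.domain) :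
    Continuous fun s : ℝ => L.phi x (L.orbit s u) (L.orbit s v) :=
  (L.continuous_phi_orbit (IsWeakFamily.const x) u v).comp (Continuous.prodMk_right (0 : ℝ))

theorem continuous_phiOne_orbit (u : L.G.domain) : Continuous fun s : ℝ => L.phiOne (L.orbit s u) :=
  Complex.continuous_re.comp (L.continuous_phi_const_orbit 1 u u)

theorem continuous_integrand {p : ℝ≥0 → H →L[ℂ] H} {C : ℝ} (hp : IsWeakFamily p C)
    (u v : L.G.domain) : Continuous fun z : ℝ × ℝ =>
      L.phi (p z.2.toNNReal) (L.orbit (z.1 - z.2) u) (L.orbit (z.1 - z.2) v) :=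
  (L.continuous_phi_orbit hp u v).comp (continuous_snd.prodMk (continuous_fst.sub continuous_snd))

/-- Condition (iii) bounds the integrand by the energy dissipation rate, whose integral the energy
balance evaluates. -/
theorem integral_phiOne_orbit_le {t : ℝ} (ht : 0 ≤ t) (u : L.G.domain) :
    ∫ s in (0 : ℝ)..t, L.phiOne (L.orbit s u) ≤ ‖(u : H)‖ ^ 2 - ‖(L.orbit t u : H)‖ ^ 2 := by
  have hc := L.continuous_coe_orbit u
  have hG := L.continuous_G_orbit u
  have h1 : ((∫ s in (0 : ℝ)..t, L.phiOne (L.orbit s u) : ℝ) : ℂ) ≤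
      ∫ s in (0 : ℝ)..t, (⟪L.G (L.orbit s u), (L.orbit s u : H)⟫_ℂ
        + ⟪(L.orbit s u : H), L.G (L.orbit s u)⟫_ℂ) := by
    rw [← intervalIntegral.integral_ofReal, ← sub_nonneg, ← intervalIntegral.integral_sub]
    · exact Complex.intervalIntegral_nonneg ht fun s => sub_nonneg.2 (L.phiOne_le_inner _)
    · exact ((hG.inner hc).add (hc.inner hG)).intervalIntegrable _ _
    · exact (Complex.continuous_ofReal.comp (L.continuous_phiOne_orbit u)).intervalIntegrable _ _
  rw [L.integral_inner_G_orbit ht, inner_self_eq_norm_sq_to_K, inner_self_eq_norm_sq_to_K] at h1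
  refine Complex.real_le_real.1 (h1.trans_eq ?_)
  push_cast
  rfl

theorem integral_phiOne_orbit_sub_le {t : ℝ} (ht : 0 ≤ t) (u : L.G.domain) :
    ∫ τ in (0 : ℝ)..t, L.phiOne (L.orbit (t - τ) u) ≤
      ‖(u : H)‖ ^ 2 - ‖(L.orbit t u : H)‖ ^ 2 := by
  have h := intervalIntegral.integral_comp_sub_left (a := 0) (b := t)
    (fun s => L.phiOne (L.orbit s u)) t
  rw [sub_self, sub_zero] at h
  rw [h]
  exact L.integral_phiOne_orbit_le ht u

section Step

variable {p : ℝ≥0 → H →L[ℂ] H} {x : H →L[ℂ] H}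

theorem intervalIntegrable_integrand {C : ℝ} (hp : IsWeakFamily p C) (t a b : ℝ)
    (u v : L.G.domain) : IntervalIntegrable (fun τ : ℝ =>
      L.phi (p τ.toNNReal) (L.orbit (t - τ) u) (L.orbit (t - τ) v)) volume a b :=
  ((L.continuous_integrand hp u v).comp (Continuous.prodMk_right t)).intervalIntegrable _ _

theorem isSesquilinear_iterateForm {C : ℝ} (hp : IsWeakFamily p C) (t : ℝ≥0) :
    IsSesquilinear (L.iterateForm p t x) := by
  refine IsSesquilinear.add (IsSesquilinear.inner_apply _ _ _)
    (IsSesquilinear.intervalIntegral (fun τ => ?_) (L.intervalIntegrable_integrand hp t 0 t))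
  exact (IsSesquilinear.of_linearMap (L.phi (p τ.toNNReal))).comp (L.orbitLinear (t - τ))

theorem norm_integral_phi_orbit_le {C : ℝ} (hb : ∀ t, ‖p t‖ ≤ C) (t : ℝ≥0) (u v : L.G.domain) :
    ‖∫ τ in (0 : ℝ)..t, L.phi (p τ.toNNReal) (L.orbit (t - τ) u) (L.orbit (t - τ) v)‖ ≤
      C / 2 * ((‖(u : H)‖ ^ 2 - ‖(L.orbit t u : H)‖ ^ 2) +
        (‖(v : H)‖ ^ 2 - ‖(L.orbit t v : H)‖ ^ 2)) := by
  have hC : 0 ≤ C := (norm_nonneg _).trans (hb 0)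
  have hi : ∀ w : L.G.domain, IntervalIntegrable
      (fun τ : ℝ => L.phiOne (L.orbit (t - τ) w)) volume 0 t := fun w =>
    ((L.continuous_phiOne_orbit w).comp (continuous_const.sub continuous_id)).intervalIntegrable _ _
  have h := intervalIntegral.norm_integral_le_of_norm_le (a := 0) (b := t) (μ := volume)
    (f := fun τ : ℝ => L.phi (p τ.toNNReal) (L.orbit (t - τ) u) (L.orbit (t - τ) v))
    (g := fun τ : ℝ => C / 2 * (L.phiOne (L.orbit (t - τ) u) + L.phiOne (L.orbit (t - τ) v)))
    t.coe_nonneg (Eventually.of_forall fun τ _ => (L.norm_phi_le _ _ _).trans (by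
      have := L.phiOne_nonneg (L.orbit (t - τ) u)
      have := L.phiOne_nonneg (L.orbit (t - τ) v)
      have := hb τ.toNNReal
      gcongr)) (((hi u).add (hi v)).const_mul _)
  refine h.trans ?_
  rw [intervalIntegral.integral_const_mul, intervalIntegral.integral_add (hi u) (hi v)]
  gcongr <;> exact L.integral_phiOne_orbit_sub_le t.coe_nonneg _

/-- The terms `-‖W_t u‖²` and `-‖W_t v‖²` in the bound of the integral cancel the contribution of
`⟪W_t u, x W_t v⟫`. The constant is therefore exactly `‖x‖` and does not grow under iteration. -/
theorem norm_iterateForm_le (hb : ∀ t, ‖p t‖ ≤ ‖x‖) (t : ℝ≥0) (u v : L.G.domain) :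
    ‖L.iterateForm p t x u v‖ ≤ ‖x‖ / 2 * (‖u‖ ^ 2 + ‖v‖ ^ 2) := by
  have h1 : ‖⟪L.W.op t u, x (L.W.op t v)⟫_ℂ‖ ≤
      ‖x‖ / 2 * (‖L.W.op t (u : H)‖ ^ 2 + ‖L.W.op t (v : H)‖ ^ 2) := by
    refine (norm_inner_apply_le _ _ _).trans ?_
    have := mul_nonneg (norm_nonneg x) (sq_nonneg (‖L.W.op t (u : H)‖ - ‖L.W.op t (v : H)‖))
    nlinarith
  have h2 := L.norm_integral_phi_orbit_le hb t u v
  rw [L.coe_orbit, L.coe_orbit, Real.toNNReal_coe] at h2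
  calc _ ≤ _ := norm_add_le _ _
    _ ≤ _ := add_le_add h1 h2
    _ = _ := by simp only [Submodule.coe_norm]; ring

theorem iterateForm_represents (hp : IsWeakFamily p ‖x‖) (t : ℝ≥0) :
    Represents (L.iterateForm p t x) (operatorOf (L.iterateForm p t x)) := by
  obtain ⟨A, hA⟩ := (L.isSesquilinear_iterateForm (x := x) hp t).exists_represents L.dense_domain
    (L.norm_iterateForm_le hp.norm_le t)
  exact hA.operatorOf

theorem continuous_inner_op (u v : H) :
    Continuous fun t : ℝ≥0 => ⟪L.W.op t u, x (L.W.op t v)⟫_ℂ :=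
  (L.W.continuous_op u).inner (x.continuous.comp (L.W.continuous_op v))

theorem continuous_iterateForm {C : ℝ} (hp : IsWeakFamily p C) (u v : L.G.domain) :
    Continuous fun t => L.iterateForm p t x u v := by
  refine (L.continuous_inner_op _ _).add ?_
  have h := intervalIntegral.continuous_parametric_intervalIntegral_of_continuous (μ := volume)
    (f := fun (t : ℝ) (τ : ℝ) => L.phi (p τ.toNNReal) (L.orbit (t - τ) u) (L.orbit (t - τ) v))
    (a₀ := 0) (L.continuous_integrand hp u v) continuous_id
  exact h.comp NNReal.continuous_coe

theorem isWeakFamily_iterateForm (hp : IsWeakFamily p ‖x‖) :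
    IsWeakFamily (fun t => operatorOf (L.iterateForm p t x)) ‖x‖ := by
  have hn : ∀ t, ‖operatorOf (L.iterateForm p t x)‖ ≤ ‖x‖ := fun t =>
    (L.iterateForm_represents hp t).norm_le L.dense_domain (norm_nonneg x)
      (L.norm_iterateForm_le hp.norm_le t)
  refine ⟨hn, fun t₀ => WeakTendsto.of_dense L.dense_domain hn fun u v => ?_⟩
  simp_rw [(L.iterateForm_represents hp _).inner_eq]
  exact (L.continuous_iterateForm hp u v).tendsto t₀

end Step

theorem isWeakFamily_conj (x : H →L[ℂ] H) :
    IsWeakFamily (fun t => star (L.W.op t) * x * L.W.op t) ‖x‖ := by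
  constructor
  · intro t
    have h1 := L.W.norm_op_le t
    calc _ ≤ ‖star (L.W.op t)‖ * ‖x‖ * ‖L.W.op t‖ := norm_mul₃_le
      _ ≤ 1 * ‖x‖ * 1 := by rw [norm_star]; gcongr
      _ = ‖x‖ := by ring
  · intro t₀ u v
    have h : ∀ t, ⟪u, (star (L.W.op t) * x * L.W.op t) v⟫_ℂ = ⟪L.W.op t u, x (L.W.op t v)⟫_ℂ :=
      fun t => by
        rw [mul_apply_eq_comp, mul_apply_eq_comp, ContinuousLinearMap.star_eq_adjoint,
          ContinuousLinearMap.adjoint_inner_right]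
    simp_rw [h]
    exact (L.continuous_inner_op u v).tendsto t₀

theorem iterate_zero (t : ℝ≥0) (x : H →L[ℂ] H) :
    L.iterate 0 t x = star (L.W.op t) * x * L.W.op t := rfl

theorem inner_iterate_zero (t : ℝ≥0) (x : H →L[ℂ] H) (u v : H) :
    ⟪u, L.iterate 0 t x v⟫_ℂ = ⟪L.W.op t u, x (L.W.op t v)⟫_ℂ := by
  rw [iterate_zero, mul_apply_eq_comp, mul_apply_eq_comp, ContinuousLinearMap.star_eq_adjoint,
    ContinuousLinearMap.adjoint_inner_right]

theorem isWeakFamily_iterate (n : ℕ) (x : H →L[ℂ] H) :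
    IsWeakFamily (fun t => L.iterate n t x) ‖x‖ := by
  induction n with
  | zero => exact L.isWeakFamily_conj x
  | succ n ih => exact L.isWeakFamily_iterateForm ih

theorem iterate_represents (n : ℕ) (t : ℝ≥0) (x : H →L[ℂ] H) :
    Represents (L.iterateForm (fun τ => L.iterate n τ x) t x) (L.iterate (n + 1) t x) :=
  L.iterateForm_represents (L.isWeakFamily_iterate n x) t

theorem iterate_add (n : ℕ) (t : ℝ≥0) (x y : H →L[ℂ] H) :
    L.iterate n t (x + y) = L.iterate n t x + L.iterate n t y := by
  induction n generalizing t with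
  | zero => simp only [iterate_zero, mul_add, add_mul]
  | succ n ih =>
    refine (L.iterate_represents n t (x + y)).unique L.dense_domain fun u v => ?_
    rw [_root_.add_apply, inner_add_right, (L.iterate_represents n t x).inner_eq,
      (L.iterate_represents n t y).inner_eq]
    simp only [iterateForm, ih, map_add, LinearMap.add_apply, _root_.add_apply, inner_add_right]
    rw [intervalIntegral.integral_add
      (L.intervalIntegrable_integrand (L.isWeakFamily_iterate n x) t 0 t u v)
      (L.intervalIntegrable_integrand (L.isWeakFamily_iterate n y) t 0 t u v)]
    ring

theorem iterate_smul (n : ℕ) (t : ℝ≥0) (c : ℂ) (x : H →L[ℂ] H) :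
    L.iterate n t (c • x) = c • L.iterate n t x := by
  induction n generalizing t with
  | zero => simp only [iterate_zero, mul_smul_comm, smul_mul_assoc]
  | succ n ih =>
    refine (L.iterate_represents n t (c • x)).unique L.dense_domain fun u v => ?_
    rw [_root_.smul_apply, inner_smul_right, (L.iterate_represents n t x).inner_eq]
    simp only [iterateForm, ih, map_smul, LinearMap.smul_apply, _root_.smul_apply,
      inner_smul_right, smul_eq_mul]
    rw [intervalIntegral.integral_const_mul]
    ring

theorem iterate_zero_nonneg (t : ℝ≥0) {x : H →L[ℂ] H} (hx : 0 ≤ x) : 0 ≤ L.iterate 0 t x := by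
  refine (operator_nonneg_iff _).2 fun u => ?_
  rw [inner_iterate_zero]
  exact (operator_nonneg_iff _).1 hx _

/-- The difference of consecutive iterates is a positive integral: of `φ(P⁽⁰⁾)` at the start, and of
`φ` applied to the previous difference afterwards. -/
theorem iterate_le_succ (n : ℕ) (t : ℝ≥0) {x : H →L[ℂ] H} (hx : 0 ≤ x) :
    L.iterate n t x ≤ L.iterate (n + 1) t x := by
  induction n generalizing t with
  | zero =>
    rw [← sub_nonneg]
    refine Represents.nonneg L.dense_domain (q := fun u v => _) (fun u v => rfl) fun u => ?_
    rw [_root_.sub_apply, inner_sub_right, (L.iterate_represents 0 t x).inner_eq,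
      inner_iterate_zero, iterateForm, add_sub_cancel_left]
    exact Complex.intervalIntegral_nonneg t.coe_nonneg fun τ =>
      L.phi_nonneg (L.iterate_zero_nonneg _ hx) _
  | succ n ih =>
    rw [← sub_nonneg]
    refine Represents.nonneg L.dense_domain (q := fun u v => _) (fun u v => rfl) fun u => ?_
    rw [_root_.sub_apply, inner_sub_right, (L.iterate_represents (n + 1) t x).inner_eq,
      (L.iterate_represents n t x).inner_eq, iterateForm, iterateForm, add_sub_add_left_eq_sub,
      ← intervalIntegral.integral_sub
        (L.intervalIntegrable_integrand (L.isWeakFamily_iterate (n + 1) x) t 0 t u u)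
        (L.intervalIntegrable_integrand (L.isWeakFamily_iterate n x) t 0 t u u)]
    exact Complex.intervalIntegral_nonneg t.coe_nonneg fun τ =>
      sub_nonneg.2 (L.phi_mono (ih _) _)

theorem iterate_monotone (t : ℝ≥0) {x : H →L[ℂ] H} (hx : 0 ≤ x) :
    Monotone fun n => L.iterate n t x :=
  monotone_nat_of_le_succ fun n => L.iterate_le_succ n t hx

theorem exists_weakTendsto_iterate (t : ℝ≥0) (x : H →L[ℂ] H) :
    ∃ a, WeakTendsto (fun n => L.iterate n t x) atTop a := by
  -- Positive operators span, and the iterates are linear in `x`, so the monotone case suffices.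
  have hx : x ∈ Submodule.span ℂ {a : H →L[ℂ] H | 0 ≤ a} := by
    rw [CStarAlgebra.span_nonneg]; trivial
  induction hx using Submodule.span_induction with
  | mem y hy =>
    exact exists_weakTendsto_of_monotone (L.iterate_monotone t hy) (L.iterate_zero_nonneg t hy)
      fun n => (L.isWeakFamily_iterate n y).norm_le t
  | zero =>
    refine ⟨0, fun u v => ?_⟩
    have h : ∀ n, L.iterate n t 0 = 0 := fun n => by simpa using L.iterate_smul n t 0 0
    simp only [h]
    exact tendsto_const_nhds
  | add y z _ _ hy hz =>
    obtain ⟨a, ha⟩ := hy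
    obtain ⟨b, hb⟩ := hz
    refine ⟨a + b, fun u v => ?_⟩
    simp only [iterate_add, _root_.add_apply, inner_add_right]
    exact (ha u v).add (hb u v)
  | smul c y _ hy =>
    obtain ⟨a, ha⟩ := hy
    refine ⟨c • a, fun u v => ?_⟩
    simp only [iterate_smul, _root_.smul_apply, inner_smul_right]
    exact (ha u v).const_mul c

theorem weakTendsto_minSemigroup (t : ℝ≥0) (x : H →L[ℂ] H) :
    WeakTendsto (fun n => L.iterate n t x) atTop (L.minSemigroup t x) := by
  have h : ∃ A : H →L[ℂ] H, ∀ u v : H,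
      Tendsto (fun n => ⟪u, L.iterate n t x v⟫_ℂ) atTop (𝓝 ⟪u, A v⟫_ℂ) :=
    L.exists_weakTendsto_iterate t x
  rw [minSemigroup, dif_pos h]
  exact h.choose_spec

theorem norm_minSemigroup_le (t : ℝ≥0) (x : H →L[ℂ] H) : ‖L.minSemigroup t x‖ ≤ ‖x‖ :=
  (L.weakTendsto_minSemigroup t x).norm_le fun n => (L.isWeakFamily_iterate n x).norm_le t

theorem isLUB_minSemigroup (t : ℝ≥0) {x : H →L[ℂ] H} (hx : 0 ≤ x) :
    IsLUB (range fun n => L.iterate n t x) (L.minSemigroup t x) :=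
  (L.weakTendsto_minSemigroup t x).isLUB (L.iterate_monotone t hx)

theorem iterate_one_le_one (n : ℕ) (t : ℝ≥0) : L.iterate n t 1 ≤ 1 := by
  have h0 : 0 ≤ L.iterate n t 1 :=
    (L.iterate_zero_nonneg t zero_le_one).trans (L.iterate_monotone t zero_le_one (Nat.zero_le n))
  have h1 : ‖L.iterate n t 1‖ ≤ 1 :=
    ((L.isWeakFamily_iterate n 1).norm_le t).trans ContinuousLinearMap.norm_id_le
  exact (CStarAlgebra.norm_le_one_iff_of_nonneg _ h0).1 h1

theorem minSemigroup_one_le_one (t : ℝ≥0) : L.minSemigroup t 1 ≤ 1 :=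
  (L.isLUB_minSemigroup t zero_le_one).2 (by rintro _ ⟨n, rfl⟩; exact L.iterate_one_le_one n t)

theorem tendsto_phi_iterate (x : H →L[ℂ] H) (t : ℝ≥0) (u v : L.G.domain) :
    Tendsto (fun n => L.phi (L.iterate n t x) u v) atTop (𝓝 (L.phi (L.minSemigroup t x) u v)) :=
  L.tendsto_phi_of_weakTendsto (fun n => (L.isWeakFamily_iterate n x).norm_le t)
    (L.weakTendsto_minSemigroup t x) u v

/-- Measurability survives pointwise limits of the continuous integrands; continuity in time of the
limit is not yet available. -/
theorem measurable_phi_minSemigroup (x : H →L[ℂ] H) (t : ℝ) (u v : L.G.domain) :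
    StronglyMeasurable fun τ : ℝ =>
      L.phi (L.minSemigroup τ.toNNReal x) (L.orbit (t - τ) u) (L.orbit (t - τ) v) :=
  stronglyMeasurable_of_tendsto atTop (fun n =>
      ((L.continuous_integrand (L.isWeakFamily_iterate n x) u v).comp
        (Continuous.prodMk_right t)).stronglyMeasurable)
    (tendsto_pi_nhds.2 fun _ => L.tendsto_phi_iterate x _ _ _)

/-- The integral equation of the minimal semigroup. -/
theorem inner_minSemigroup_eq (t : ℝ≥0) (x : H →L[ℂ] H) :
    Represents (L.iterateForm (fun τ => L.minSemigroup τ x) t x) (L.minSemigroup t x) := by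
  intro u v
  have h1 := (tendsto_add_atTop_iff_nat 1).2 (L.weakTendsto_minSemigroup t x u v)
  refine tendsto_nhds_unique h1 ?_
  simp_rw [(L.iterate_represents _ t x).inner_eq, iterateForm]
  refine tendsto_const_nhds.add ?_
  refine intervalIntegral.tendsto_integral_filter_of_dominated_convergence
    (fun _ => ‖x‖ * (L.graphNorm u * L.graphNorm v)) (Eventually.of_forall fun n => ?_)
    (Eventually.of_forall fun n => Eventually.of_forall fun τ _ => ?_)
    intervalIntegrable_const (Eventually.of_forall fun τ _ => L.tendsto_phi_iterate x _ _ _)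
  · exact ((L.continuous_integrand (L.isWeakFamily_iterate n x) u v).comp
      (Continuous.prodMk_right (t : ℝ))).aestronglyMeasurable
  · have h0 := mul_nonneg (L.graphNorm_nonneg u) (L.graphNorm_nonneg v)
    exact (L.norm_phi_orbit_le _ _ _ _).trans
      (mul_le_mul_of_nonneg_right ((L.isWeakFamily_iterate n x).norm_le _) h0)

/-- Continuity need not pass to a pointwise limit of the iterates; it is read off the integral
equation. -/
theorem isWeakFamily_minSemigroup (x : H →L[ℂ] H) :
    IsWeakFamily (fun t => L.minSemigroup t x) ‖x‖ := by
  have hn := fun t => L.norm_minSemigroup_le t x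
  refine ⟨hn, fun t₀ => WeakTendsto.of_dense L.dense_domain hn fun u v => ?_⟩
  simp_rw [(L.inner_minSemigroup_eq _ x).inner_eq, iterateForm]
  refine ((L.continuous_inner_op _ _).tendsto t₀).add ?_
  set K := ‖x‖ * (L.graphNorm u * L.graphNorm v) with hK
  set F : ℝ → ℝ → ℂ := fun t τ =>
    L.phi (L.minSemigroup τ.toNNReal x) (L.orbit (t - τ) u) (L.orbit (t - τ) v) with hF
  have hFb : ∀ t τ, ‖F t τ‖ ≤ K := fun t τ => (L.norm_phi_orbit_le _ _ _ _).trans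
    (mul_le_mul_of_nonneg_right (hn _) (mul_nonneg (L.graphNorm_nonneg u) (L.graphNorm_nonneg v)))
  have hFm : ∀ t, StronglyMeasurable (F t) := fun t => L.measurable_phi_minSemigroup x t u v
  have hFi : ∀ t a b, IntervalIntegrable (F t) volume a b := fun t a b =>
    (intervalIntegrable_const (c := K)).mono_fun (hFm t).aestronglyMeasurable
      (Eventually.of_forall fun τ => by
        rw [Real.norm_of_nonneg ((norm_nonneg _).trans (hFb t τ))]; exact hFb t τ)
  -- The integral is split at `t₀`: on `[0, t₀]` only the orbit times depend on `t`, and the piece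
  -- from `t₀` to `t` is small by its length.
  have hc1 : ContinuousAt (fun t : ℝ => ∫ τ in (0 : ℝ)..t₀, F t τ) t₀ :=
    intervalIntegral.continuousAt_of_dominated_interval (bound := fun _ => K)
      (Eventually.of_forall fun t => (hFm t).aestronglyMeasurable)
      (Eventually.of_forall fun t => Eventually.of_forall fun τ _ => hFb t τ)
      intervalIntegrable_const (Eventually.of_forall fun τ _ =>
        ((L.continuous_phi_const_orbit _ u v).comp
          (continuous_id.sub continuous_const)).continuousAt)
  have hc2 : Tendsto (fun t : ℝ => ∫ τ in (t₀ : ℝ)..t, F t τ) (𝓝 (t₀ : ℝ)) (𝓝 0) := by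
    refine squeeze_zero_norm (a := fun t : ℝ => K * |t - t₀|)
      (fun t => intervalIntegral.norm_integral_le_of_norm_le_const fun τ _ => hFb t τ) ?_
    have : Continuous fun t : ℝ => K * |t - t₀| := by fun_prop
    simpa using this.tendsto (t₀ : ℝ)
  have h := (hc1.tendsto.add hc2).comp (NNReal.continuous_coe.tendsto t₀)
  rw [add_zero] at h
  refine h.congr fun t => ?_
  exact intervalIntegral.integral_add_adjacent_intervals (hFi _ _ _) (hFi _ _ _)

end FormalGenerator

/-! ### Laplace transforms of convolutions and of operator families. -/

section Laplace

/-- Fubini's theorem for the Laplace transform of a generalized convolution. -/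
theorem integral_Ioi_integral_sub {K : ℝ → ℝ → ℂ} (hK : Integrable (Function.uncurry K)
      ((volume.restrict (Ioi (0 : ℝ))).prod (volume.restrict (Ioi (0 : ℝ))))) :
    ∫ t in Ioi (0 : ℝ), ∫ τ in (0 : ℝ)..t, K τ (t - τ) =
      ∫ τ in Ioi (0 : ℝ), ∫ s in Ioi (0 : ℝ), K τ s := by
  set S : Set (ℝ × ℝ) := Ioi 0 ×ˢ Ioi 0 with hS
  have hSm : MeasurableSet S := measurableSet_Ioi.prod measurableSet_Ioi
  set K' : ℝ × ℝ → ℂ := S.indicator (Function.uncurry K) with hK'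
  have hi : Integrable K' (volume.prod volume) := by
    rw [hK', integrable_indicator_iff hSm, IntegrableOn, ← Measure.prod_restrict]
    exact hK
  -- The shear `(t, τ) ↦ (t - τ, τ)` preserves Lebesgue measure. The indicator of the open quadrant
  -- encodes `0 < τ < t` after the shear.
  have hi2 : Integrable (Function.uncurry fun t τ : ℝ => K' (τ, t - τ))
      (volume.prod volume) := by
    have h := (measurePreserving_sub_prod (volume : Measure ℝ) (volume : Measure ℝ))
    exact (h.integrable_comp hi.swap.aestronglyMeasurable).2 hi.swap
  have e1 : ∀ t : ℝ, 0 < t → ∫ τ in (0 : ℝ)..t, K τ (t - τ) = ∫ τ, K' (τ, t - τ) := fun t ht => by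
    rw [intervalIntegral.integral_of_le ht.le, integral_Ioc_eq_integral_Ioo,
      ← integral_indicator measurableSet_Ioo]
    refine integral_congr_ae (Eventually.of_forall fun τ => ?_)
    by_cases h : τ ∈ Ioo 0 t
    · have h' : (τ, t - τ) ∈ S := ⟨h.1, sub_pos.2 h.2⟩
      simp only [hK', indicator_of_mem h, indicator_of_mem h', Function.uncurry]
    · have h' : (τ, t - τ) ∉ S := fun h' => h ⟨h'.1, sub_pos.1 h'.2⟩
      simp only [hK', indicator_of_notMem h, indicator_of_notMem h']
  have e2 : ∀ t : ℝ, t ∉ Ioi (0 : ℝ) → ∫ τ, K' (τ, t - τ) = 0 := fun t ht => by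
    rw [← integral_zero ℝ ℂ]
    refine integral_congr_ae (Eventually.of_forall fun τ => ?_)
    have h' : (τ, t - τ) ∉ S := fun h' => ht ((show (0 : ℝ) < τ from h'.1).trans (sub_pos.1 h'.2))
    simp only [hK', indicator_of_notMem h']
  rw [setIntegral_congr_fun measurableSet_Ioi fun t ht => e1 t ht,
    setIntegral_eq_integral_of_forall_compl_eq_zero e2, integral_integral_swap hi2,
    ← integral_indicator measurableSet_Ioi]
  refine integral_congr_ae (Eventually.of_forall fun τ => ?_)
  simp only
  rw [integral_sub_right_eq_self (fun s => K' (τ, s)) τ]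
  by_cases h : τ ∈ Ioi (0 : ℝ)
  · rw [indicator_of_mem h, ← integral_indicator measurableSet_Ioi]
    refine integral_congr_ae (Eventually.of_forall fun s => ?_)
    by_cases hs : s ∈ Ioi (0 : ℝ)
    · have h' : (τ, s) ∈ S := ⟨h, hs⟩
      simp only [hK', indicator_of_mem hs, indicator_of_mem h', Function.uncurry]
    · have h' : (τ, s) ∉ S := fun h' => hs h'.2
      simp only [hK', indicator_of_notMem hs, indicator_of_notMem h']
  · rw [indicator_of_notMem h, ← integral_zero ℝ ℂ]
    refine integral_congr_ae (Eventually.of_forall fun s => ?_)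
    have h' : (τ, s) ∉ S := fun h' => h h'.1
    simp only [hK', indicator_of_notMem h']

variable {r : ℝ}

theorem norm_exp_mul (t : ℝ) (z : ℂ) :
    ‖(Real.exp (-r * t) : ℂ) * z‖ = Real.exp (-r * t) * ‖z‖ := by
  rw [norm_mul, Complex.norm_real, Real.norm_of_nonneg (Real.exp_pos _).le]

theorem integrableOn_exp_mul (hr : 0 < r) {f : ℝ → ℂ} {C : ℝ}
    (hf : AEStronglyMeasurable f (volume.restrict (Ioi 0)))
    (hb : ∀ t, 0 < t → ‖f t‖ ≤ C) :
    IntegrableOn (fun t : ℝ => (Real.exp (-r * t) : ℂ) * f t) (Ioi 0) := by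
  refine Integrable.mono' ((exp_neg_integrableOn_Ioi 0 hr).mul_const C)
    ((Continuous.aestronglyMeasurable (by fun_prop)).mul hf)
    ((ae_restrict_iff' measurableSet_Ioi).2 (Eventually.of_forall fun t ht => ?_))
  rw [norm_exp_mul]
  exact mul_le_mul_of_nonneg_left (hb t ht) (Real.exp_pos _).le

theorem integral_exp_neg_mul (hr : 0 < r) :
    ∫ t in Ioi (0 : ℝ), Real.exp (-r * t) = 1 / r := by
  rw [integral_exp_mul_Ioi (neg_lt_zero.2 hr)]
  simp

theorem integral_exp_mul_const (hr : 0 < r) (z : ℂ) :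
    ∫ t in Ioi (0 : ℝ), (Real.exp (-r * t) : ℂ) * z = 1 / r * z := by
  have h : ∫ t in Ioi (0 : ℝ), (Real.exp (-r * t) : ℂ) =
      ((∫ t in Ioi (0 : ℝ), Real.exp (-r * t) : ℝ) : ℂ) := integral_ofReal
  rw [integral_mul_const, h, integral_exp_neg_mul hr]
  push_cast
  rfl

theorem ofReal_exp_nonneg (t : ℝ) : (0 : ℂ) ≤ Real.exp t :=
  Complex.zero_le_real.2 (Real.exp_pos _).le

theorem norm_integral_exp_mul_le (hr : 0 < r) {f : ℝ → ℂ} {C : ℝ}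
    (hb : ∀ t, 0 < t → ‖f t‖ ≤ C) :
    ‖∫ t in Ioi (0 : ℝ), (Real.exp (-r * t) : ℂ) * f t‖ ≤ C / r := by
  refine (norm_integral_le_of_norm_le ((exp_neg_integrableOn_Ioi 0 hr).mul_const C)
    ((ae_restrict_iff' measurableSet_Ioi).2 (Eventually.of_forall fun t ht => ?_))).trans ?_
  · rw [norm_exp_mul]
    exact mul_le_mul_of_nonneg_left (hb t ht) (Real.exp_pos _).le
  · rw [integral_mul_const, integral_exp_neg_mul hr, one_div_mul_eq_div]

variable {H : Type*} [NormedAddCommGroup H] [InnerProductSpace ℂ H]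

/-- The Laplace transform `∫₀^∞ e^{-rt} p_t dt` of a family of operators, as a weak integral. -/
noncomputable def laplace (r : ℝ) (p : ℝ≥0 → H →L[ℂ] H) : H →L[ℂ] H :=
  operatorOf fun u v : (⊤ : Submodule ℂ H) =>
    ∫ t in Ioi (0 : ℝ), (Real.exp (-r * t) : ℂ) * ⟪(u : H), p t.toNNReal v⟫_ℂ

variable {p : ℝ≥0 → H →L[ℂ] H} {C : ℝ}

theorem IsWeakFamily.continuous_toNNReal (hp : IsWeakFamily p C) (u v : H) :
    Continuous fun t : ℝ => ⟪u, p t.toNNReal v⟫_ℂ :=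
  (hp.continuous u v).comp continuous_real_toNNReal

theorem IsWeakFamily.norm_inner_le (hp : IsWeakFamily p C) (t : ℝ≥0) (u v : H) :
    ‖⟪u, p t v⟫_ℂ‖ ≤ C * ‖u‖ * ‖v‖ :=
  (norm_inner_apply_le _ _ _).trans (by gcongr; exact hp.norm_le t)

theorem IsWeakFamily.integrableOn (hp : IsWeakFamily p C) (hr : 0 < r) (u v : H) :
    IntegrableOn (fun t : ℝ => (Real.exp (-r * t) : ℂ) * ⟪u, p t.toNNReal v⟫_ℂ) (Ioi 0) :=
  integrableOn_exp_mul hr (hp.continuous_toNNReal u v).aestronglyMeasurable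
    fun _ _ => hp.norm_inner_le _ u v

theorem IsWeakFamily.laplace_represents [CompleteSpace H] (hp : IsWeakFamily p C) (hr : 0 < r) :
    Represents (fun u v : (⊤ : Submodule ℂ H) =>
      ∫ t in Ioi (0 : ℝ), (Real.exp (-r * t) : ℂ) * ⟪(u : H), p t.toNNReal v⟫_ℂ)
      (laplace r p) := by
  have hs : IsSesquilinear (fun u v : (⊤ : Submodule ℂ H) =>
      ∫ t in Ioi (0 : ℝ), (Real.exp (-r * t) : ℂ) * ⟪(u : H), p t.toNNReal v⟫_ℂ) :=
    IsSesquilinear.integral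
      (fun t => (IsSesquilinear.inner_apply 1 1 (p t.toNNReal)).const_mul _)
      fun u v => hp.integrableOn hr _ _
  obtain ⟨A, hA⟩ := hs.exists_represents (C := C / r) (by simp) fun u v => by
    refine (norm_integral_exp_mul_le hr (C := C / 2 * (‖(u : H)‖ ^ 2 + ‖(v : H)‖ ^ 2))
      fun t _ => (hp.norm_inner_le _ _ _).trans ?_).trans ?_
    · have := mul_nonneg hp.nonneg (sq_nonneg (‖(u : H)‖ - ‖(v : H)‖))
      nlinarith
    · simp only [Submodule.coe_norm]
      exact le_of_eq (by ring)
  exact hA.operatorOf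

theorem IsWeakFamily.inner_laplace [CompleteSpace H] (hp : IsWeakFamily p C) (hr : 0 < r)
    (u v : H) : ⟪u, laplace r p v⟫_ℂ =
      ∫ t in Ioi (0 : ℝ), (Real.exp (-r * t) : ℂ) * ⟪u, p t.toNNReal v⟫_ℂ :=
  (hp.laplace_represents hr) ⟨u, trivial⟩ ⟨v, trivial⟩

theorem laplace_const [CompleteSpace H] (hr : 0 < r) (a : H →L[ℂ] H) :
    laplace r (fun _ => a) = (1 / (r : ℂ)) • a := by
  ext v
  refine ext_inner_left ℂ fun u => ?_
  rw [(IsWeakFamily.const a).inner_laplace hr, integral_exp_mul_const hr, smul_apply,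
    inner_smul_right]

end Laplace

/-! ### The map `Q_r`, the form `ℓ_r` and the resolvent identities. -/

namespace FormalGenerator

variable {H : Type*} [NormedAddCommGroup H] [InnerProductSpace ℂ H] [CompleteSpace H]
  (L : FormalGenerator H) {r : ℝ}

theorem resolvent_eq_laplace (r : ℝ) (x : H →L[ℂ] H) :
    L.resolvent r x = laplace r fun t => L.minSemigroup t x := rfl

theorem integrableOn_exp_mul_phi (hr : 0 < r) (x : H →L[ℂ] H) (u v : L.G.domain) :
    IntegrableOn (fun t : ℝ => (Real.exp (-r * t) : ℂ) * L.phi x (L.orbit t u) (L.orbit t v))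
      (Ioi 0) :=
  integrableOn_exp_mul hr (L.continuous_phi_const_orbit x u v).aestronglyMeasurable
    fun t _ => L.norm_phi_orbit_le x t u v

theorem integrableOn_exp_mul_phiOne (hr : 0 < r) (u : L.G.domain) :
    IntegrableOn (fun t : ℝ => Real.exp (-r * t) * L.phiOne (L.orbit t u)) (Ioi 0) := by
  have h := (L.integrableOn_exp_mul_phi hr 1 u u).re
  refine h.congr (Eventually.of_forall fun t => ?_)
  exact Complex.re_ofReal_mul _ _

/-- Since `e^{-rt} ≤ 1`, the energy bound holds on each `[0, T]` uniformly in `T`. The constant `1`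
here is what makes `Q_r` contractive. -/
theorem integral_exp_mul_phiOne_le (hr : 0 < r) (u : L.G.domain) :
    ∫ t in Ioi (0 : ℝ), Real.exp (-r * t) * L.phiOne (L.orbit t u) ≤ ‖(u : H)‖ ^ 2 := by
  refine le_of_tendsto (intervalIntegral_tendsto_integral_Ioi 0
    (L.integrableOn_exp_mul_phiOne hr u) tendsto_id) ?_
  filter_upwards [eventually_ge_atTop 0] with T hT
  have hc := L.continuous_phiOne_orbit u
  calc ∫ t in (0 : ℝ)..T, Real.exp (-r * t) * L.phiOne (L.orbit t u)
      ≤ ∫ t in (0 : ℝ)..T, L.phiOne (L.orbit t u) := by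
        refine intervalIntegral.integral_mono_on hT
          (Continuous.intervalIntegrable (by fun_prop) _ _) (hc.intervalIntegrable _ _)
          fun t ht => mul_le_of_le_one_left (L.phiOne_nonneg _) (Real.exp_le_one_iff.2 ?_)
        have := mul_nonneg hr.le ht.1
        linarith
    _ ≤ _ := L.integral_phiOne_orbit_le hT u
    _ ≤ _ := sub_le_self _ (sq_nonneg _)

theorem isSesquilinear_QForm (hr : 0 < r) (x : H →L[ℂ] H) : IsSesquilinear (L.QForm r x) :=
  IsSesquilinear.integral
    (fun t => ((IsSesquilinear.of_linearMap (L.phi x)).comp (L.orbitLinear t)).const_mul _)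
    (L.integrableOn_exp_mul_phi hr x)

theorem norm_QForm_le (hr : 0 < r) (x : H →L[ℂ] H) (u v : L.G.domain) :
    ‖L.QForm r x u v‖ ≤ ‖x‖ / 2 * (‖u‖ ^ 2 + ‖v‖ ^ 2) := by
  have hi := L.integrableOn_exp_mul_phiOne hr
  refine (norm_integral_le_of_norm_le (((hi u).add (hi v)).const_mul (‖x‖ / 2))
    (Eventually.of_forall fun t => ?_)).trans ?_
  · rw [norm_exp_mul]
    calc _ ≤ Real.exp (-r * t) * (‖x‖ / 2 * (L.phiOne (L.orbit t u) + L.phiOne (L.orbit t v))) :=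
          mul_le_mul_of_nonneg_left (L.norm_phi_le _ _ _) (Real.exp_pos _).le
      _ = _ := by simp only [Pi.add_apply]; ring
  · rw [integral_const_mul]
    simp only [Pi.add_apply]
    rw [integral_add (hi u) (hi v)]
    have hu := L.integral_exp_mul_phiOne_le hr u
    have hv := L.integral_exp_mul_phiOne_le hr v
    simp only [Submodule.coe_norm]
    gcongr

theorem Q_represents (hr : 0 < r) (x : H →L[ℂ] H) : Represents (L.QForm r x) (L.Q r x) := by
  obtain ⟨A, hA⟩ := (L.isSesquilinear_QForm hr x).exists_represents L.dense_domain
    (L.norm_QForm_le hr x)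
  exact hA.operatorOf

theorem Q_add (hr : 0 < r) (x y : H →L[ℂ] H) : L.Q r (x + y) = L.Q r x + L.Q r y := by
  refine (L.Q_represents hr (x + y)).unique L.dense_domain fun u v => ?_
  rw [_root_.add_apply, inner_add_right, (L.Q_represents hr x).inner_eq,
    (L.Q_represents hr y).inner_eq, QForm, QForm, QForm,
    ← integral_add (L.integrableOn_exp_mul_phi hr x u v) (L.integrableOn_exp_mul_phi hr y u v)]
  simp only [map_add, LinearMap.add_apply, mul_add]

theorem Q_smul (hr : 0 < r) (c : ℂ) (x : H →L[ℂ] H) : L.Q r (c • x) = c • L.Q r x := by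
  refine (L.Q_represents hr (c • x)).unique L.dense_domain fun u v => ?_
  rw [_root_.smul_apply, inner_smul_right, (L.Q_represents hr x).inner_eq, QForm, QForm,
    ← integral_const_mul]
  simp only [map_smul, LinearMap.smul_apply, smul_eq_mul]
  refine integral_congr_ae (Eventually.of_forall fun t => ?_)
  ring

theorem Q_sub (hr : 0 < r) (x y : H →L[ℂ] H) : L.Q r (x - y) = L.Q r x - L.Q r y := by
  rw [eq_sub_iff_add_eq, ← L.Q_add hr, sub_add_cancel]

theorem Q_nonneg (hr : 0 < r) {x : H →L[ℂ] H} (hx : 0 ≤ x) : 0 ≤ L.Q r x :=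
  (L.Q_represents hr x).nonneg L.dense_domain fun _ => integral_nonneg fun _ =>
    mul_nonneg (ofReal_exp_nonneg _) (L.phi_nonneg hx _)

theorem Q_mono (hr : 0 < r) {x y : H →L[ℂ] H} (hxy : x ≤ y) : L.Q r x ≤ L.Q r y := by
  rw [← sub_nonneg, ← L.Q_sub hr]
  exact L.Q_nonneg hr (sub_nonneg.2 hxy)

section Convolution

variable {p : ℝ≥0 → H →L[ℂ] H} {C : ℝ}

theorem norm_integral_phi_orbit_le_const (hp : IsWeakFamily p C) {t : ℝ} (ht : 0 < t)
    (u v : L.G.domain) :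
    ‖∫ τ in (0 : ℝ)..t, L.phi (p τ.toNNReal) (L.orbit (t - τ) u) (L.orbit (t - τ) v)‖ ≤
      C / 2 * (‖(u : H)‖ ^ 2 + ‖(v : H)‖ ^ 2) := by
  have h := L.norm_integral_phi_orbit_le hp.norm_le ⟨t, ht.le⟩ u v
  have hC := hp.nonneg
  refine h.trans ?_
  gcongr <;> exact sub_le_self _ (sq_nonneg _)

theorem integrableOn_exp_mul_integral_phi (hr : 0 < r) (hp : IsWeakFamily p C)
    (u v : L.G.domain) : IntegrableOn (fun t : ℝ => (Real.exp (-r * t) : ℂ) *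
      ∫ τ in (0 : ℝ)..t, L.phi (p τ.toNNReal) (L.orbit (t - τ) u) (L.orbit (t - τ) v)) (Ioi 0) := by
  refine integrableOn_exp_mul hr (Continuous.aestronglyMeasurable ?_)
    fun t ht => L.norm_integral_phi_orbit_le_const hp ht u v
  exact intervalIntegral.continuous_parametric_intervalIntegral_of_continuous (μ := volume)
    (f := fun (t : ℝ) (τ : ℝ) => L.phi (p τ.toNNReal) (L.orbit (t - τ) u) (L.orbit (t - τ) v))
    (a₀ := 0) (L.continuous_integrand hp u v) continuous_id

/-- The factor `e^{-rt}` splits as `e^{-rτ} e^{-r(t-τ)}`. Fubini separates the two times, and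
normality carries the integral over `τ` inside `φ`. -/
theorem integral_exp_mul_integral_phi (hr : 0 < r) (hp : IsWeakFamily p C) (u v : L.G.domain) :
    ∫ t in Ioi (0 : ℝ), (Real.exp (-r * t) : ℂ) *
      ∫ τ in (0 : ℝ)..t, L.phi (p τ.toNNReal) (L.orbit (t - τ) u) (L.orbit (t - τ) v) =
    L.QForm r (laplace r p) u v := by
  set M := C * (L.graphNorm u * L.graphNorm v) with hM
  have hphi : ∀ τ s : ℝ, ‖L.phi (p τ.toNNReal) (L.orbit s u) (L.orbit s v)‖ ≤ M := fun τ s =>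
    (L.norm_phi_orbit_le _ _ _ _).trans (mul_le_mul_of_nonneg_right (hp.norm_le _)
      (mul_nonneg (L.graphNorm_nonneg u) (L.graphNorm_nonneg v)))
  set K : ℝ → ℝ → ℂ := fun τ s => (Real.exp (-r * s) : ℂ) *
    ((Real.exp (-r * τ) : ℂ) * L.phi (p τ.toNNReal) (L.orbit s u) (L.orbit s v)) with hK
  have hKi : Integrable (Function.uncurry K)
      ((volume.restrict (Ioi (0 : ℝ))).prod (volume.restrict (Ioi (0 : ℝ)))) := by
    have he := exp_neg_integrableOn_Ioi 0 hr
    refine ((he.mul_prod he).mul_const M).mono' (Continuous.aestronglyMeasurable ?_)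
      (Eventually.of_forall fun z => ?_)
    · have := L.continuous_phi_orbit hp u v
      simp only [hK, Function.uncurry_def]
      fun_prop
    · simp only [Function.uncurry, hK]
      rw [norm_exp_mul, norm_exp_mul]
      exact le_of_eq_of_le (by ring) (mul_le_mul_of_nonneg_left (hphi z.1 z.2)
        (mul_pos (Real.exp_pos (-r * z.1)) (Real.exp_pos (-r * z.2))).le)
  have e : ∀ t : ℝ, (Real.exp (-r * t) : ℂ) *
      ∫ τ in (0 : ℝ)..t, L.phi (p τ.toNNReal) (L.orbit (t - τ) u) (L.orbit (t - τ) v) =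
      ∫ τ in (0 : ℝ)..t, K τ (t - τ) := fun t => by
    rw [← intervalIntegral.integral_const_mul]
    refine intervalIntegral.integral_congr fun τ _ => ?_
    simp only [hK]
    rw [← mul_assoc, ← Complex.ofReal_mul, ← Real.exp_add]
    ring_nf
  simp_rw [e]
  rw [integral_Ioi_integral_sub hKi, integral_integral_swap hKi, QForm]
  refine integral_congr_ae (Eventually.of_forall fun s => ?_)
  simp only [hK]
  rw [integral_const_mul]
  congr 1
  refine L.integral_mul_phi (C := C) (fun t => hp.norm_le _) ?_
    (fun a b => hp.integrableOn hr a b) (fun a b => (hp.inner_laplace hr a b).symm) _ _ ?_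
  · exact (exp_neg_integrableOn_Ioi 0 hr).ofReal
  · refine integrableOn_exp_mul hr (C := M) (Continuous.aestronglyMeasurable ?_)
      fun τ _ => hphi τ s
    exact (L.continuous_phi_orbit hp u v).comp (Continuous.prodMk_left s)

end Convolution

theorem laplace_iterate_succ (hr : 0 < r) (n : ℕ) (x : H →L[ℂ] H) :
    laplace r (fun t => L.iterate (n + 1) t x) =
      laplace r (fun t => L.iterate 0 t x) + L.Q r (laplace r fun t => L.iterate n t x) := by
  refine Represents.unique L.dense_domain (q := fun u v => _) (fun u v => rfl) fun u v => ?_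
  have hn := L.isWeakFamily_iterate n x
  beta_reduce
  rw [_root_.add_apply, inner_add_right, (L.Q_represents hr _).inner_eq,
    (L.isWeakFamily_iterate 0 x).inner_laplace hr,
    (L.isWeakFamily_iterate (n + 1) x).inner_laplace hr,
    ← L.integral_exp_mul_integral_phi hr hn,
    ← integral_add ((L.isWeakFamily_iterate 0 x).integrableOn hr _ _)
      (L.integrableOn_exp_mul_integral_phi hr hn u v)]
  refine setIntegral_congr_fun measurableSet_Ioi fun t ht => ?_
  rw [(L.iterate_represents n _ x).inner_eq, inner_iterate_zero, iterateForm,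
    Real.coe_toNNReal _ (le_of_lt ht), mul_add]

theorem continuous_generatorForm_orbit (u v : L.G.domain) :
    Continuous fun s => generatorForm L.G L.phi 1 (L.orbit s u) (L.orbit s v) :=
  ((L.continuous_phi_const_orbit 1 u v).sub
    ((L.continuous_G_orbit u).inner (L.continuous_coe_orbit v))).sub
    ((L.continuous_coe_orbit u).inner (L.continuous_G_orbit v))

/-- The energy balance integrates the `G`-terms of `𝓛(I)`, so only `φ(I)` remains under the
integral. -/
theorem defect_eq {t : ℝ} (ht : 0 ≤ t) (u v : L.G.domain) :
    L.defect t u v = ⟪(u : H), v⟫_ℂ - ⟪L.W.op t.toNNReal u, L.W.op t.toNNReal v⟫_ℂ -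
      ∫ τ in (0 : ℝ)..t, L.phi 1 (L.orbit (t - τ) u) (L.orbit (t - τ) v) := by
  have h := intervalIntegral.integral_comp_sub_left (a := 0) (b := t)
    (fun s => generatorForm L.G L.phi 1 (L.orbit s u) (L.orbit s v)) t
  have h' := intervalIntegral.integral_comp_sub_left (a := 0) (b := t)
    (fun s => L.phi 1 (L.orbit s u) (L.orbit s v)) t
  rw [sub_self, sub_zero] at h h'
  have h2 := L.integral_inner_G_orbit ht u v
  rw [L.coe_orbit, L.coe_orbit] at h2
  rw [defect, h, h', ← h2, ← intervalIntegral.integral_neg, ← intervalIntegral.integral_sub]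
  · refine intervalIntegral.integral_congr fun s _ => ?_
    simp only [generatorForm, _root_.one_apply_eq_self]
    ring
  · exact (((L.continuous_G_orbit u).inner (L.continuous_coe_orbit v)).add
      ((L.continuous_coe_orbit u).inner (L.continuous_G_orbit v))).intervalIntegrable _ _
  · exact (L.continuous_phi_const_orbit 1 u v).intervalIntegrable _ _

theorem exp_mul_defect_eq {t : ℝ} (ht : 0 ≤ t) (u v : L.G.domain) :
    (Real.exp (-r * t) : ℂ) * L.defect t u v =
      (Real.exp (-r * t) : ℂ) * ⟪(u : H), v⟫_ℂ
      - (Real.exp (-r * t) : ℂ) * ⟪(u : H), L.iterate 0 t.toNNReal 1 v⟫_ℂ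
      - (Real.exp (-r * t) : ℂ) *
        ∫ τ in (0 : ℝ)..t, L.phi 1 (L.orbit (t - τ) u) (L.orbit (t - τ) v) := by
  rw [L.defect_eq ht, inner_iterate_zero, _root_.one_apply_eq_self]
  ring

theorem integrableOn_exp_mul_defect (hr : 0 < r) (u v : L.G.domain) :
    IntegrableOn (fun t : ℝ => (Real.exp (-r * t) : ℂ) * L.defect t u v) (Ioi 0) := by
  refine IntegrableOn.congr_fun ?_ (fun t ht => (L.exp_mul_defect_eq (le_of_lt ht) u v).symm)
    measurableSet_Ioi
  exact (((IsWeakFamily.const (1 : H →L[ℂ] H)).integrableOn hr _ _).sub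
    ((L.isWeakFamily_iterate 0 1).integrableOn hr _ _)).sub
    (L.integrableOn_exp_mul_integral_phi hr (IsWeakFamily.const 1) u v)

/-- This is the Laplace transform of `defect_eq`: the `φ(I)` term is a convolution with the constant
family `I`, whose transform is `r⁻¹ I`. -/
theorem ellForm_represents (hr : 0 < r) : Represents (L.ellForm r)
    ((1 / (r : ℂ)) • 1 - laplace r (fun t => L.iterate 0 t 1)
      - L.Q r ((1 / (r : ℂ)) • 1)) := by
  intro u v
  have hc := (IsWeakFamily.const (1 : H →L[ℂ] H))
  have h0 := L.isWeakFamily_iterate 0 1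
  have hsub : IntegrableOn (fun t : ℝ => (Real.exp (-r * t) : ℂ) * ⟪(u : H), (1 : H →L[ℂ] H) v⟫_ℂ
      - (Real.exp (-r * t) : ℂ) * ⟪(u : H), L.iterate 0 t.toNNReal 1 v⟫_ℂ) (Ioi 0) :=
    (hc.integrableOn hr _ _).sub (h0.integrableOn hr _ _)
  rw [_root_.sub_apply, _root_.sub_apply, inner_sub_right, inner_sub_right,
    (L.Q_represents hr _).inner_eq, ← laplace_const hr, hc.inner_laplace hr, h0.inner_laplace hr,
    ← L.integral_exp_mul_integral_phi hr hc,
    ← integral_sub (hc.integrableOn hr _ _) (h0.integrableOn hr _ _),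
    ← integral_sub hsub
      (L.integrableOn_exp_mul_integral_phi hr hc u v)]
  exact setIntegral_congr_fun measurableSet_Ioi fun t ht =>
    (L.exp_mul_defect_eq (le_of_lt ht) u v).symm

theorem ell_represents (hr : 0 < r) : Represents (L.ellForm r) (L.ell r) :=
  (L.ellForm_represents hr).operatorOf

theorem ell_eq (hr : 0 < r) : L.ell r = (1 / (r : ℂ)) • 1
    - laplace r (fun t => L.iterate 0 t 1) - L.Q r ((1 / (r : ℂ)) • 1) :=
  (L.ell_represents hr).unique L.dense_domain (L.ellForm_represents hr)

theorem ell_nonneg (hr : 0 < r) : 0 ≤ L.ell r := by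
  refine (L.ell_represents hr).nonneg L.dense_domain fun u =>
    integral_nonneg_of_ae <| (ae_restrict_iff' measurableSet_Ioi).2 <|
      Eventually.of_forall fun t ht => mul_nonneg (ofReal_exp_nonneg _) ?_
  rw [defect, ← intervalIntegral.integral_neg]
  exact Complex.intervalIntegral_nonneg (le_of_lt ht) fun τ =>
    neg_nonneg.2 (L.generatorForm_one_nonpos _)

theorem weakTendsto_laplace_iterate (hr : 0 < r) (x : H →L[ℂ] H) :
    WeakTendsto (fun n => laplace r fun t => L.iterate n t x) atTop (L.resolvent r x) := by
  intro u v
  rw [resolvent_eq_laplace, (L.isWeakFamily_minSemigroup x).inner_laplace hr]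
  simp_rw [(L.isWeakFamily_iterate _ x).inner_laplace hr]
  refine tendsto_integral_of_dominated_convergence
    (fun t => Real.exp (-r * t) * (‖x‖ * ‖u‖ * ‖v‖))
    (fun n => ((L.isWeakFamily_iterate n x).integrableOn hr u v).aestronglyMeasurable)
    ((exp_neg_integrableOn_Ioi 0 hr).mul_const _)
    (fun n => Eventually.of_forall fun t => ?_)
    (Eventually.of_forall fun t => (L.weakTendsto_minSemigroup _ x u v).const_mul _)
  rw [norm_exp_mul]
  exact mul_le_mul_of_nonneg_left ((L.isWeakFamily_iterate n x).norm_inner_le _ u v)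
    (Real.exp_pos _).le

end FormalGenerator

/-! ### Limits of the resolvent defects and the equivalences. -/

namespace FormalGenerator

variable {H : Type*} [NormedAddCommGroup H] [InnerProductSpace ℂ H] [CompleteSpace H]
  (L : FormalGenerator H) {r : ℝ}

theorem wellDefined : L.WellDefined where
  dense_domain := L.dense_domain
  iterate_integrable n t x u v :=
    L.intervalIntegrable_integrand (L.isWeakFamily_iterate n x) t 0 t u v
  iterate_represents := L.iterate_represents
  iterate_monotone t _ hx := L.iterate_monotone t hx
  minSemigroup_isLUB t _ hx := L.isLUB_minSemigroup t hx
  minSemigroup_tendsto t x u v := L.weakTendsto_minSemigroup t x u v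
  resolvent_integrable _ hr x u v := (L.isWeakFamily_minSemigroup x).integrableOn hr u v
  resolvent_represents _ hr x := (L.isWeakFamily_minSemigroup x).laplace_represents hr
  Q_integrable _ hr x u v := L.integrableOn_exp_mul_phi hr x u v
  Q_represents _ hr x := L.Q_represents hr x
  defect_integrable _ _ u v := ((L.continuous_generatorForm_orbit u v).comp
    (continuous_const.sub continuous_id)).intervalIntegrable _ _
  ell_integrable _ hr u v := L.integrableOn_exp_mul_defect hr u v
  ell_represents _ hr := L.ell_represents hr

theorem laplace_iterate_zero_nonneg (hr : 0 < r) :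
    0 ≤ laplace r fun t => L.iterate 0 t 1 := by
  refine (operator_nonneg_iff _).2 fun u => ?_
  rw [(L.isWeakFamily_iterate 0 1).inner_laplace hr]
  exact integral_nonneg fun t => mul_nonneg (ofReal_exp_nonneg _)
    ((operator_nonneg_iff _).1 (L.iterate_zero_nonneg _ zero_le_one) u)

theorem one_div_smul_nonneg (hr : 0 < r) {a : H →L[ℂ] H} (ha : 0 ≤ a) :
    0 ≤ (1 / (r : ℂ)) • a := by
  refine smul_nonneg ?_ ha
  rw [← Complex.ofReal_one, ← Complex.ofReal_div]
  exact Complex.zero_le_real.2 (by positivity)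

/-- The identity for `ℓ` exhibits `r⁻¹ (I - Q(I))` as `ℓ + R⁽⁰⁾(I)`, a sum of positive operators. -/
theorem Q_one_le_one (hr : 0 < r) : L.Q r 1 ≤ 1 := by
  have h : 0 ≤ (1 / (r : ℂ)) • (1 - L.Q r 1) := by
    have e : (1 / (r : ℂ)) • (1 - L.Q r 1) = L.ell r + laplace r fun t => L.iterate 0 t 1 := by
      rw [L.ell_eq hr, L.Q_smul hr, smul_sub]
      abel
    rw [e]
    exact add_nonneg (L.ell_nonneg hr) (L.laplace_iterate_zero_nonneg hr)
  have h2 : 0 ≤ (r : ℂ) • ((1 / (r : ℂ)) • (1 - L.Q r 1)) :=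
    smul_nonneg (Complex.zero_le_real.2 hr.le) h
  have hr' : (r : ℂ) ≠ 0 := by exact_mod_cast hr.ne'
  rw [smul_smul, mul_one_div_cancel hr', one_smul] at h2
  exact sub_nonneg.1 h2

theorem Q_iterate_nonneg (hr : 0 < r) (n : ℕ) : 0 ≤ (L.Q r)^[n] 1 := by
  induction n with
  | zero => exact zero_le_one
  | succ n ih => rw [Function.iterate_succ_apply']; exact L.Q_nonneg hr ih

theorem Q_iterate_antitone (hr : 0 < r) : Antitone fun n => (L.Q r)^[n] 1 := by
  refine antitone_nat_of_succ_le fun n => ?_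
  induction n with
  | zero => exact L.Q_one_le_one hr
  | succ n ih =>
    simpa only [Function.iterate_succ_apply'] using L.Q_mono hr ih

theorem exists_weakTendsto_Q_iterate (hr : 0 < r) :
    ∃ a, WeakTendsto (fun n => (L.Q r)^[n] 1) atTop a := by
  have hle : ∀ n, (L.Q r)^[n] 1 ≤ 1 := fun n => L.Q_iterate_antitone hr (Nat.zero_le n)
  obtain ⟨b, hb⟩ := exists_weakTendsto_of_monotone (x := fun n => 1 - (L.Q r)^[n] 1)
    (fun m n hmn => sub_le_sub_left (L.Q_iterate_antitone hr hmn) _)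
    (sub_nonneg.2 (hle 0))
    (C := ‖(1 : H →L[ℂ] H)‖) fun n => CStarAlgebra.norm_le_norm_of_nonneg_of_le
      (sub_nonneg.2 (hle n)) (sub_le_self _ (L.Q_iterate_nonneg hr n))
  refine ⟨1 - b, fun u v => ?_⟩
  have h := (hb u v).const_sub ⟪u, (1 : H →L[ℂ] H) v⟫_ℂ
  simpa [inner_sub_right] using h

/-- The defect `r⁻¹ I - ∫₀^∞ e^{-rt} P⁽ⁿ⁾_t(I) dt` of the resolvent iterates. -/
noncomputable def resolventDefect (r : ℝ) (n : ℕ) : H →L[ℂ] H :=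
  (1 / (r : ℂ)) • 1 - laplace r fun t => L.iterate n t 1

theorem resolventDefect_zero (hr : 0 < r) :
    L.resolventDefect r 0 = L.ell r + (1 / (r : ℂ)) • (L.Q r)^[1] 1 := by
  rw [resolventDefect, L.ell_eq hr, Function.iterate_one, L.Q_smul hr]
  abel

theorem resolventDefect_succ (hr : 0 < r) (n : ℕ) :
    L.resolventDefect r (n + 1) = L.ell r + L.Q r (L.resolventDefect r n) := by
  rw [resolventDefect, resolventDefect, L.laplace_iterate_succ hr, L.ell_eq hr, L.Q_sub hr]
  abel

/-- The defect is `∑_{k ≤ n} Q^k(ℓ) + r⁻¹ Q^{n+1}(I)`; dropping the positive sum leaves this bound.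
The exponent is `n + 1` because the defect of index `0` already contains one application of `Q`. -/
theorem resolventDefect_ge (hr : 0 < r) (n : ℕ) :
    (1 / (r : ℂ)) • (L.Q r)^[n + 1] 1 ≤ L.resolventDefect r n := by
  induction n with
  | zero => rw [L.resolventDefect_zero hr]; exact le_add_of_nonneg_left (L.ell_nonneg hr)
  | succ n ih =>
    rw [L.resolventDefect_succ hr, Function.iterate_succ_apply', ← L.Q_smul hr]
    exact (L.Q_mono hr ih).trans (le_add_of_nonneg_left (L.ell_nonneg hr))

theorem resolventDefect_nonneg (hr : 0 < r) (n : ℕ) : 0 ≤ L.resolventDefect r n :=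
  (one_div_smul_nonneg hr (L.Q_iterate_nonneg hr _)).trans (L.resolventDefect_ge hr n)

theorem ell_le_resolventDefect (hr : 0 < r) (n : ℕ) : L.ell r ≤ L.resolventDefect r n := by
  cases n with
  | zero =>
    rw [L.resolventDefect_zero hr]
    exact le_add_of_nonneg_right (one_div_smul_nonneg hr (L.Q_iterate_nonneg hr 1))
  | succ n =>
    rw [L.resolventDefect_succ hr]
    exact le_add_of_nonneg_right (L.Q_nonneg hr (L.resolventDefect_nonneg hr n))

theorem resolventDefect_eq_of_ell_eq_zero (hr : 0 < r) (h : L.ell r = 0) (n : ℕ) :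
    L.resolventDefect r n = (1 / (r : ℂ)) • (L.Q r)^[n + 1] 1 := by
  induction n with
  | zero => rw [L.resolventDefect_zero hr, h, zero_add]
  | succ n ih =>
    rw [L.resolventDefect_succ hr, h, zero_add, ih, L.Q_smul hr,
      Function.iterate_succ_apply' _ (n + 1)]

theorem weakTendsto_resolventDefect (hr : 0 < r) :
    WeakTendsto (L.resolventDefect r) atTop ((1 / (r : ℂ)) • 1 - L.resolvent r 1) := by
  intro u v
  simp only [resolventDefect, _root_.sub_apply, inner_sub_right]
  exact (L.weakTendsto_laplace_iterate hr 1 u v).const_sub _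

/-- The limit of the defects dominates both `ℓ` and `r⁻¹ q`, so it can vanish only if both do. If `ℓ
= 0`, the defects are exactly `r⁻¹ Q^{n+1}(I)`. -/
theorem resolvent_one_eq_iff (hr : 0 < r) {q : H →L[ℂ] H}
    (hq : WeakTendsto (fun n => (L.Q r)^[n] 1) atTop q) :
    L.resolvent r 1 = (1 / (r : ℂ)) • 1 ↔ L.ell r = 0 ∧ q = 0 := by
  have hr' : (r : ℂ) ≠ 0 := by exact_mod_cast hr.ne'
  have hD := L.weakTendsto_resolventDefect hr
  have hq' : WeakTendsto (fun n => (1 / (r : ℂ)) • (L.Q r)^[n + 1] 1) atTop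
      ((1 / (r : ℂ)) • q) := fun u v => by
    simp only [_root_.smul_apply, inner_smul_right]
    exact ((tendsto_add_atTop_iff_nat 1).2 (hq u v)).const_mul _
  have hq0 : 0 ≤ q := WeakTendsto.le (x := fun _ => 0) (fun _ _ => tendsto_const_nhds) hq
    (L.Q_iterate_nonneg hr)
  constructor
  · intro h
    rw [h, sub_self] at hD
    refine ⟨le_antisymm ?_ (L.ell_nonneg hr), ?_⟩
    · exact WeakTendsto.le (x := fun _ => L.ell r) (fun _ _ => tendsto_const_nhds) hD
        (L.ell_le_resolventDefect hr)
    · have h1 := le_antisymm (WeakTendsto.le hq' hD (L.resolventDefect_ge hr))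
        (one_div_smul_nonneg hr hq0)
      exact (smul_eq_zero.1 h1).resolve_left (one_div_ne_zero hr')
  · rintro ⟨h1, rfl⟩
    rw [smul_zero] at hq'
    have h2 : L.resolventDefect r = fun n => (1 / (r : ℂ)) • (L.Q r)^[n + 1] 1 :=
      funext (L.resolventDefect_eq_of_ell_eq_zero hr h1)
    rw [h2] at hD
    exact (sub_eq_zero.1 (hD.unique hq')).symm

theorem resolvent_one_le (hr : 0 < r) : L.resolvent r 1 ≤ (1 / (r : ℂ)) • 1 :=
  sub_nonneg.1 (WeakTendsto.le (x := fun _ => 0) (fun _ _ => tendsto_const_nhds)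
    (L.weakTendsto_resolventDefect hr) (L.resolventDefect_nonneg hr))

/-- For the converse, `⟪u, (I - P_t(I)) u⟫` is nonnegative and continuous in `t`, so a vanishing
weighted integral forces it to vanish identically. -/
theorem isConservative_iff_resolvent_one_eq (hr : 0 < r) :
    L.IsConservative ↔ L.resolvent r 1 = (1 / (r : ℂ)) • 1 := by
  rw [resolvent_eq_laplace]
  constructor
  · intro h
    rw [← laplace_const hr]
    exact congrArg _ (funext h)
  · intro h t
    have hm := L.isWeakFamily_minSemigroup 1
    have hc := IsWeakFamily.const (1 : H →L[ℂ] H)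
    refine operator_ext_quadratic fun u => ?_
    set f : ℝ → ℂ := fun s => ⟪u, (1 : H →L[ℂ] H) u⟫_ℂ - ⟪u, L.minSemigroup s.toNNReal 1 u⟫_ℂ
      with hf
    have hfc : Continuous f := continuous_const.sub (hm.continuous_toNNReal u u)
    have hf0 : ∀ s, 0 ≤ f s := fun s =>
      sub_nonneg.2 ((operator_le_iff _ _).1 (L.minSemigroup_one_le_one _) u)
    have hfr : ∀ s, 0 ≤ (f s).re := fun s => (Complex.le_def.1 (hf0 s)).1
    have hint : IntegrableOn (fun s : ℝ => (Real.exp (-r * s) : ℂ) * f s) (Ioi 0) := by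
      simp only [hf, mul_sub]
      exact (hc.integrableOn hr u u).sub (hm.integrableOn hr u u)
    have h0 : ∫ s in Ioi (0 : ℝ), (Real.exp (-r * s) : ℂ) * f s = 0 := by
      simp only [hf, mul_sub]
      rw [integral_sub (hc.integrableOn hr u u) (hm.integrableOn hr u u), ← hc.inner_laplace hr,
        ← hm.inner_laplace hr, h, laplace_const hr, sub_self]
    have h1 : ∫ s in Ioi (0 : ℝ), Real.exp (-r * s) * (f s).re = 0 := by
      have h2 := integral_re hint
      rw [h0] at h2
      simpa only [RCLike.re_eq_complex_re, Complex.re_ofReal_mul, Complex.zero_re] using h2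
    have hint' : IntegrableOn (fun s : ℝ => Real.exp (-r * s) * (f s).re) (Ioi 0) :=
      hint.re.congr (Eventually.of_forall fun s => Complex.re_ofReal_mul _ _)
    rw [integral_eq_zero_iff_of_nonneg
      (fun s => mul_nonneg (Real.exp_pos _).le (hfr s)) hint'] at h1
    have hcont : Continuous fun s : ℝ => Real.exp (-r * s) * (f s).re := by fun_prop
    -- Almost everywhere becomes everywhere on `(0, ∞)` by continuity; taking the closure adds `t =
    -- 0`.
    have h2 := Measure.eqOn_open_of_ae_eq h1 isOpen_Ioi hcont.continuousOn continuousOn_const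
    have h3 := h2.closure hcont continuous_const
    rw [closure_Ioi] at h3
    have h4 := h3 (show (t : ℝ) ∈ Ici 0 from t.coe_nonneg)
    have h5 : (f t).re = 0 := by
      simpa [(Real.exp_pos _).ne'] using h4
    have h6 : f t = 0 := Complex.ext h5 (Complex.le_def.1 (hf0 t)).2.symm
    simp only [hf, Real.toNNReal_coe] at h6
    exact (sub_eq_zero.1 h6).symm

end FormalGenerator

theorem theorem3p1 {H : Type*} [NormedAddCommGroup H] [InnerProductSpace ℂ H] [CompleteSpace H]
    [TopologicalSpace.SeparableSpace H] (L : FormalGenerator H) :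
    L.WellDefined ∧
    ∀ r : ℝ, 0 < r →
      ∃ Qlim : H →L[ℂ] H,
        (∀ u : H, Tendsto (fun n : ℕ => ((L.Q r)^[n] 1) u) atTop (𝓝 (Qlim u))) ∧
        List.TFAE [
          ¬ L.IsConservative,
          L.ell r ≠ 0 ∨ Qlim ≠ 0,
          L.resolvent r 1 < (1 / (r : ℂ)) • (1 : H →L[ℂ] H)] := by
  refine ⟨L.wellDefined, fun r hr => ?_⟩
  obtain ⟨q, hq⟩ := L.exists_weakTendsto_Q_iterate hr
  refine ⟨q, hq.tendsto_apply_of_antitone (L.Q_iterate_antitone hr), ?_⟩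
  have hlt : L.resolvent r 1 < (1 / (r : ℂ)) • (1 : H →L[ℂ] H) ↔
      L.resolvent r 1 ≠ (1 / (r : ℂ)) • (1 : H →L[ℂ] H) := by
    rw [lt_iff_le_and_ne, and_iff_right (L.resolvent_one_le hr)]
  -- After these rewrites all three conditions say that the resolvent at `I` differs from `r⁻¹ I`.
  rw [L.isConservative_iff_resolvent_one_eq hr, hlt, ← not_and_or (a := L.ell r = 0),
    ← L.resolvent_one_eq_iff hr hq]
  simp
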